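/- **Setting.** Let $k$ be an algebraically closed field of characteristic $0$, $A$ a finitely generated commutative unital $k$-algebra, $X=\operatorname{Spec}A$, and $\mathfrak g$ a finite-dimensional reductive Lie algebra over $k$. Let $\Gamma$ be a finite group acting on $A$ (hence on $X$) by $k$-algebra automorphisms and on $\mathfrak g$ by Lie algebra automorphisms. Let $\mathfrak M=M(X,\mathfrak g)^\Gamma=(\mathfrak g\otimes_k A)^\Gamma$ be the equivariant map algebra, the fixed points of the diagonal action. For a rational point $x$ of $X$ let $\Gamma_x$ be its stabilizer, $\mathfrak g^x=\{u\in\mathfrak g:\gamma u=u\ \forall\gamma\in\Gamma_x\}$ (a reductive Lie algebra), $\mathfrak g^x_{ss}=[\mathfrak g^x,\mathfrak g^x]$, and $\mathfrak g^x_{ab}$ the center of $\mathfrak g^x$. Let $\mathrm{ev}_x:\mathfrak M\to\mathfrak g^x$, $\alpha\mapsto\alpha(x)$, be evaluation, which is surjective, and put $$\mathfrak K_x=\operatorname{Ker}\mathrm{ev}_x,\qquad \mathfrak Z_x=\mathrm{ev}_x^{-1}(\mathfrak g^x_{ab}).$$ For an ideal $J\supseteq\mathfrak K_x$ of $\mathfrak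 M$ put $J_{ab}=J/[J,J]$. The adjoint action of $\mathfrak M$ on $J_{ab}$ is trivial on $\mathfrak K_x$, so it makes $J_{ab}$ a module over $\mathfrak g^x\cong\mathfrak M/\mathfrak K_x$, and by restriction over $\mathfrak g^x_{ss}$. **Theorem.** Let $V$ and $V'$ be irreducible finite-dimensional single orbit evaluation representations of $\mathfrak M$ supported on the same orbit $\Gamma\cdot x$; that is, $V$ and $V'$ are irreducible finite-dimensional representations of $\mathfrak g^x$, regarded as representations of $\mathfrak M$ through $\mathrm{ev}_x$. Suppose that $\mathfrak g^x_{ab}$ acts on $V$ and $V'$ by linear forms $\lambda$ and $\lambda'$ respectively. Then $$\mathfrak Z_x=\{\alpha\in\mathfrak M:[\alpha,\mathfrak M]\subseteq\mathfrak K_x\},$$ and, as vector spaces over $k$, $$\operatorname{Ext}^1_{\mathfrak M}(V,V')\cong\begin{cases}\operatorname{Hom}_{\mathfrak g^x}(\mathfrak K_{x,ab},\,V^*\otimes V') & \text{if }\lambda\neq\lambda',\\ \operatorname{Hom}_{\mathfrak g^x_{ss}}(\mathfrak Z_{x,ab},\,V^*\otimes V') & \text{if }\lambda=\lambda'.\end{cases}$$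 In particular, if $\mathfrak g^x$ is semisimple, then $\mathfrak g^x=\mathfrak g^x_{ss}$, $\lambda=\lambda'=0$, $\mathfrak K_x=\mathfrak Z_x$, and $$\operatorname{Ext}^1_{\mathfrak M}(V,V')\cong\operatorname{Hom}_{\mathfrak g^x}(\mathfrak K_{x,ab},\,V^*\otimes V').$$ -/

import Mathlib

open scoped TensorProduct

universe u w

namespace EquivariantMap

section LieAut

variable {k : Type*} {L : Type*} [CommRing k] [LieRing L] [LieAlgebra k L]

/-- The group of automorphisms of a Lie algebra, under composition. -/
instance instGroupLieAut : Group (L ≃ₗ⁅k⁆ L) where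
  mul f g := g.trans f
  one := LieEquiv.refl
  inv f := f.symm
  mul_assoc _ _ _ := rfl
  one_mul _ := rfl
  mul_one _ := rfl
  inv_mul_cancel f := by
    ext a
    exact f.symm_apply_apply a

theorem lieAut_mul_apply (f g : L ≃ₗ⁅k⁆ L) (a : L) : (f * g) a = f (g a) := rfl

theorem lieAut_one_apply (a : L) : (1 : L ≃ₗ⁅k⁆ L) a = a := rfl

end LieAut

section Algebras

variable {k A 𝔤 : Type u} {Γ : Type w} [Field k] [CommRing A] [Algebra k A]
  [LieRing 𝔤] [LieAlgebra k 𝔤] [Group Γ]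
  (φ : Γ →* (A ≃ₐ[k] A)) (ψ : Γ →* (𝔤 ≃ₗ⁅k⁆ 𝔤))

/-- The action of `Γ` on the rational points of `X = Spec A`, a rational point being given by the
evaluation homomorphism `x : A → k`; one has `a (γ • x) = (γ⁻¹ • a) (x)`. -/
def pointAct (γ : Γ) (x : A →ₐ[k] k) : A →ₐ[k] k :=
  x.comp (φ γ⁻¹ : A →ₐ[k] A)

theorem pointAct_apply (γ : Γ) (x : A →ₐ[k] k) (a : A) : pointAct φ γ x a = x (φ γ⁻¹ a) := rfl

theorem pointAct_one (x : A →ₐ[k] k) : pointAct φ 1 x = x := by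
  ext a
  simp [pointAct_apply]

theorem pointAct_mul (γ δ : Γ) (x : A →ₐ[k] k) :
    pointAct φ (γ * δ) x = pointAct φ γ (pointAct φ δ x) := by
  ext a
  simp [pointAct_apply]

/-- The isotropy group `Γ_x`. -/
def isotropyGroup (x : A →ₐ[k] k) : Subgroup Γ where
  carrier := {γ | pointAct φ γ x = x}
  one_mem' := pointAct_one φ x
  mul_mem' := by
    intro γ δ hγ hδ
    change pointAct φ (γ * δ) x = x
    rw [pointAct_mul, show pointAct φ δ x = x from hδ, show pointAct φ γ x = x from hγ]
  inv_mem' := by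
    intro γ hγ
    change pointAct φ γ⁻¹ x = x
    conv_lhs => rw [← show pointAct φ γ x = x from hγ]
    rw [← pointAct_mul, inv_mul_cancel, pointAct_one]

theorem mem_isotropyGroup {x : A →ₐ[k] k} {γ : Γ} :
    γ ∈ isotropyGroup φ x ↔ pointAct φ γ x = x := Iff.rfl

/-- The isotropy subalgebra `𝔤^x`, the fixed points of `Γ_x` in `𝔤`. -/
def isotropyAlgebra (x : A →ₐ[k] k) : LieSubalgebra k 𝔤 where
  carrier := {v | ∀ γ ∈ isotropyGroup φ x, ψ γ v = v}
  add_mem' := by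
    intro v v₁ hv hw γ hγ
    rw [map_add, hv γ hγ, hw γ hγ]
  zero_mem' := by
    intro γ _
    exact map_zero _
  smul_mem' := by
    intro c v hv γ hγ
    rw [map_smul, hv γ hγ]
  lie_mem' := by
    intro v v₁ hv hw γ hγ
    rw [LieEquiv.map_lie, hv γ hγ, hw γ hγ]

/-- The diagonal action of `γ ∈ Γ` on `M(X, 𝔤) = A ⊗ 𝔤`. -/
noncomputable def diagAct (γ : Γ) : A ⊗[k] 𝔤 →ₗ⁅k⁆ A ⊗[k] 𝔤 :=
  LieAlgebra.ExtendScalars.map (φ γ : A →ₐ[k] A) (ψ γ : 𝔤 →ₗ⁅k⁆ 𝔤)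

theorem diagAct_tmul (γ : Γ) (a : A) (v : 𝔤) :
    diagAct φ ψ γ (a ⊗ₜ[k] v) = φ γ a ⊗ₜ[k] ψ γ v := rfl

theorem diagAct_mul (γ δ : Γ) (α : A ⊗[k] 𝔤) :
    diagAct φ ψ (γ * δ) α = diagAct φ ψ γ (diagAct φ ψ δ α) := by
  induction α with
  | zero => simp
  | add a b ha hb => rw [map_add, map_add, map_add, ha, hb]
  | tmul a v => simp [diagAct_tmul, lieAut_mul_apply]

/-- The equivariant map algebra `𝔐 = M(X, 𝔤)^Γ`. -/
noncomputable def equivariantMapAlgebra : LieSubalgebra k (A ⊗[k] 𝔤) where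
  carrier := {α | ∀ γ, diagAct φ ψ γ α = α}
  add_mem' := by
    intro a b ha hb γ
    rw [map_add, ha γ, hb γ]
  zero_mem' := by
    intro γ
    exact map_zero _
  smul_mem' := by
    intro c a ha γ
    rw [map_smul, ha γ]
  lie_mem' := by
    intro a b ha hb γ
    rw [LieHom.map_lie, ha γ, hb γ]

/-- Evaluation at `x` of maps `X → 𝔤`, that is, `a ⊗ v ↦ a(x) v`. -/
noncomputable def evalFull (x : A →ₐ[k] k) : A ⊗[k] 𝔤 →ₗ⁅k⁆ 𝔤 :=
  { TensorProduct.lift ((LinearMap.lsmul k 𝔤).comp x.toLinearMap) with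
    map_lie' := by
      intro a b
      simp only [AddHom.toFun_eq_coe, LinearMap.coe_toAddHom]
      induction a with
      | zero => simp
      | add a a₁ ha ha₁ => simp only [add_lie, map_add, ha, ha₁]
      | tmul a v =>
        induction b with
        | zero => simp
        | add b b₁ hb hb₁ => simp only [lie_add, map_add, hb, hb₁]
        | tmul b v₁ => simp [mul_smul, smul_comm (x b) (x a)] }

theorem evalFull_tmul (x : A →ₐ[k] k) (a : A) (v : 𝔤) :
    evalFull x (a ⊗ₜ[k] v) = x a • v := rfl

theorem evalFull_diagAct (x : A →ₐ[k] k) (γ : Γ) (α : A ⊗[k] 𝔤) :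
    evalFull x (diagAct φ ψ γ α) = ψ γ (evalFull (pointAct φ γ⁻¹ x) α) := by
  induction α with
  | zero => simp
  | add a b ha hb => rw [map_add, map_add, map_add, map_add, ha, hb]
  | tmul a v => simp [diagAct_tmul, evalFull_tmul, pointAct_apply]

/-- The evaluation map `ev_x : 𝔐 → 𝔤^x`. -/
noncomputable def ev (x : A →ₐ[k] k) :
    equivariantMapAlgebra φ ψ →ₗ⁅k⁆ isotropyAlgebra φ ψ x where
  toFun α := ⟨evalFull x (α : A ⊗[k] 𝔤), by
    intro γ hγ
    have h := evalFull_diagAct φ ψ x γ (α : A ⊗[k] 𝔤)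
    rw [α.2 γ, (mem_isotropyGroup φ).1 (inv_mem hγ)] at h
    exact h.symm⟩
  map_add' _ _ := Subtype.ext (map_add _ _ _)
  map_smul' c α := Subtype.ext (map_smul (evalFull x) c (α : A ⊗[k] 𝔤))
  map_lie' {α β} := Subtype.ext (LieHom.map_lie (evalFull x) (α : A ⊗[k] 𝔤) (β : A ⊗[k] 𝔤))

theorem coe_ev (x : A →ₐ[k] k) (α : equivariantMapAlgebra φ ψ) :
    (ev φ ψ x α : 𝔤) = evalFull x (α : A ⊗[k] 𝔤) := rfl

theorem exists_separating [Finite Γ] (x : A →ₐ[k] k) :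
    ∃ a : A, x a = 1 ∧ ∀ γ : Γ, γ ∉ isotropyGroup φ x → pointAct φ γ x a = 0 := by
  classical
  have := Fintype.ofFinite Γ
  have key : ∀ γ : Γ, ∃ a : A, x a = 1 ∧ (γ ∉ isotropyGroup φ x → pointAct φ γ x a = 0) := by
    intro γ
    by_cases hγ : γ ∈ isotropyGroup φ x
    · exact ⟨1, map_one x, fun h => absurd hγ h⟩
    · have hne : ∃ b, pointAct φ γ x b ≠ x b := by
        by_contra hcon
        push Not at hcon
        exact hγ (AlgHom.ext hcon)
      obtain ⟨b, hb⟩ := hne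
      have hb0 : x b - pointAct φ γ x b ≠ 0 := sub_ne_zero.2 hb.symm
      refine ⟨(x b - pointAct φ γ x b)⁻¹ • (b - algebraMap k A (pointAct φ γ x b)), ?_, ?_⟩
      · rw [map_smul, map_sub, AlgHom.commutes]
        exact inv_mul_cancel₀ hb0
      · intro _
        rw [map_smul, map_sub, AlgHom.commutes]
        simp
  choose a ha ha₀ using key
  refine ⟨∏ γ, a γ, ?_, ?_⟩
  · rw [map_prod]
    exact Finset.prod_eq_one fun γ _ => ha γ
  · intro γ hγ
    rw [map_prod]
    exact Finset.prod_eq_zero (Finset.mem_univ γ) (ha₀ γ hγ)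

/-- The evaluation map `𝔐 → 𝔤^x` is onto; this is what makes `𝔤^x` act on the modules below. -/
theorem ev_surjective [CharZero k] [Finite Γ] (x : A →ₐ[k] k) :
    Function.Surjective (ev φ ψ x) := by
  classical
  have := Fintype.ofFinite Γ
  rintro ⟨v, hv⟩
  obtain ⟨a, ha, ha₀⟩ := exists_separating φ x
  have hmem : ∑ γ : Γ, diagAct φ ψ γ (a ⊗ₜ[k] v) ∈ equivariantMapAlgebra φ ψ := by
    intro δ
    rw [map_sum]
    simp only [← diagAct_mul]
    exact Fintype.sum_equiv (Equiv.mulLeft δ) _ _ fun γ => rfl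
  have hval : evalFull x (∑ γ : Γ, diagAct φ ψ γ (a ⊗ₜ[k] v)) =
      (Nat.card (isotropyGroup φ x) : k) • v := by
    have hterm : ∀ γ : Γ, evalFull x (diagAct φ ψ γ (a ⊗ₜ[k] v)) =
        if γ ∈ isotropyGroup φ x then v else 0 := by
      intro γ
      rw [evalFull_diagAct, evalFull_tmul, map_smul]
      split_ifs with hγ
      · rw [(mem_isotropyGroup φ).1 (inv_mem hγ), ha, one_smul, hv γ hγ]
      · rw [ha₀ γ⁻¹ (fun h => hγ (by simpa using inv_mem h)), zero_smul]
    rw [map_sum, Finset.sum_congr rfl fun γ _ => hterm γ, Finset.sum_ite, Finset.sum_const,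
      Finset.sum_const_zero, add_zero, Nat.card_eq_fintype_card, Fintype.card_subtype,
      Nat.cast_smul_eq_nsmul]
  have hcard : (Nat.card (isotropyGroup φ x) : k) ≠ 0 := by
    exact_mod_cast Nat.card_pos.ne'
  refine ⟨(Nat.card (isotropyGroup φ x) : k)⁻¹ • ⟨_, hmem⟩, ?_⟩
  rw [map_smul]
  refine Subtype.ext ?_
  change (Nat.card (isotropyGroup φ x) : k)⁻¹ •
    evalFull x (∑ γ : Γ, diagAct φ ψ γ (a ⊗ₜ[k] v)) = v
  rw [hval, smul_smul, inv_mul_cancel₀ hcard, one_smul]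

/-- The ideal `𝔎_x = Ker ev_x` of `𝔐`. -/
noncomputable def kerEv (x : A →ₐ[k] k) : LieIdeal k (equivariantMapAlgebra φ ψ) :=
  (ev φ ψ x).ker

/-- The ideal `ℨ_x = ev_x⁻¹(𝔤^x_ab)` of `𝔐`, where `𝔤^x_ab` is the center of `𝔤^x`. -/
noncomputable def centEv (x : A →ₐ[k] k) : LieIdeal k (equivariantMapAlgebra φ ψ) :=
  (LieAlgebra.center k (isotropyAlgebra φ ψ x)).comap (ev φ ψ x)

theorem ker_le_kerEv (x : A →ₐ[k] k) : (ev φ ψ x).ker ≤ kerEv φ ψ x := le_rfl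

theorem ker_le_centEv (x : A →ₐ[k] k) : (ev φ ψ x).ker ≤ centEv φ ψ x := by
  intro α hα
  rw [LieHom.mem_ker] at hα
  rw [centEv, LieIdeal.mem_comap, hα]
  exact zero_mem _

end Algebras

section Modules

variable {k L G : Type*} [Field k] [LieRing L] [LieAlgebra k L] [LieRing G] [LieAlgebra k G]

/-- The semisimple part `L_ss = L' = [L, L]` of a reductive Lie algebra `L`. -/
def semisimplePart (k L : Type*) [Field k] [LieRing L] [LieAlgebra k L] : LieIdeal k L :=
  ⁅(⊤ : LieIdeal k L), (⊤ : LieIdeal k L)⁆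

/-- For an ideal `J` of `L`, the derived algebra `J' = [J, J]` as an `L`-submodule of `J`. -/
def derivedIn (J : LieIdeal k L) : LieSubmodule k L J :=
  LieSubmodule.comap (LieSubmodule.incl J) ⁅J, J⁆

/-- The abelianization `J_ab = J / [J, J]` of an ideal `J ⊇ Ker f` of `L`, where `f : L → G` is
an epimorphism of Lie algebras. It depends on `f` only through the `G`-action defined below. -/
def IdealAb (f : L →ₗ⁅k⁆ G) (_hf : Function.Surjective f) (J : LieIdeal k L)
    (_hJ : f.ker ≤ J) : Type _ :=
  J ⧸ derivedIn J

namespace IdealAb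

variable {f : L →ₗ⁅k⁆ G} {hf : Function.Surjective f} {J : LieIdeal k L} {hJ : f.ker ≤ J}

instance instAddCommGroup : AddCommGroup (IdealAb f hf J hJ) :=
  inferInstanceAs (AddCommGroup (J ⧸ derivedIn J))

instance instModule : Module k (IdealAb f hf J hJ) :=
  inferInstanceAs (Module k (J ⧸ derivedIn J))

/-- The quotient map `J → J_ab`. -/
def mk (a : J) : IdealAb f hf J hJ := LieSubmodule.Quotient.mk (N := derivedIn J) a

theorem mk_surjective : Function.Surjective (mk : J → IdealAb f hf J hJ) :=
  Submodule.Quotient.mk_surjective _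

theorem mk_add (a b : J) : (mk (a + b) : IdealAb f hf J hJ) = mk a + mk b := rfl

theorem mk_smul (c : k) (a : J) : (mk (c • a) : IdealAb f hf J hJ) = c • mk a := rfl

theorem mk_eq_zero (a : J) :
    (mk a : IdealAb f hf J hJ) = 0 ↔ (a : L) ∈ (⁅J, J⁆ : LieIdeal k L) :=
  Submodule.Quotient.mk_eq_zero _

/-- The action of `l ∈ L` on `J_ab` induced by the adjoint representation. -/
def adAct (l : L) (n : IdealAb f hf J hJ) : IdealAb f hf J hJ :=
  (⁅l, (show J ⧸ derivedIn J from n)⁆ : J ⧸ derivedIn J)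

theorem adAct_mk (l : L) (a : J) :
    adAct l (mk a : IdealAb f hf J hJ) = mk ⁅l, a⁆ := rfl

theorem adAct_congr {l l₁ : L} (h : f l = f l₁) (n : IdealAb f hf J hJ) :
    adAct l n = adAct l₁ n := by
  obtain ⟨a, rfl⟩ := mk_surjective n
  rw [adAct_mk, adAct_mk, ← sub_eq_zero]
  change mk (⁅l, a⁆ - ⁅l₁, a⁆) = (0 : IdealAb f hf J hJ)
  rw [mk_eq_zero]
  change ⁅l, (a : L)⁆ - ⁅l₁, (a : L)⁆ ∈ ⁅J, J⁆
  rw [← sub_lie]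
  refine LieSubmodule.lie_mem_lie (hJ ?_) a.2
  rw [LieHom.mem_ker, map_sub, h, sub_self]

/-- The action of `G ≅ L / Ker f` on `J_ab` induced by the adjoint representation of `L`:
for `l ∈ L` the element `f l` acts by `[a] ↦ [⁅l, a⁆]`, see `lie_mk`. -/
noncomputable instance instBracket : Bracket G (IdealAb f hf J hJ) where
  bracket g n := adAct (Function.surjInv hf g) n

theorem lie_eq (l : L) (n : IdealAb f hf J hJ) : ⁅f l, n⁆ = adAct l n :=
  adAct_congr (Function.surjInv_eq hf (f l)) n

theorem lie_mk (l : L) (a : J) : ⁅f l, (mk a : IdealAb f hf J hJ)⁆ = mk ⁅l, a⁆ := by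
  rw [lie_eq, adAct_mk]

noncomputable instance instLieRingModule : LieRingModule G (IdealAb f hf J hJ) where
  add_lie g g₁ n := by
    obtain ⟨l, rfl⟩ := hf g
    obtain ⟨l₁, rfl⟩ := hf g₁
    obtain ⟨a, rfl⟩ := mk_surjective n
    rw [← map_add, lie_mk, lie_mk, lie_mk, add_lie, mk_add]
  lie_add g n n₁ := by
    obtain ⟨l, rfl⟩ := hf g
    obtain ⟨a, rfl⟩ := mk_surjective n
    obtain ⟨b, rfl⟩ := mk_surjective n₁
    rw [← mk_add, lie_mk, lie_mk, lie_mk, lie_add, mk_add]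
  leibniz_lie g g₁ n := by
    obtain ⟨l, rfl⟩ := hf g
    obtain ⟨l₁, rfl⟩ := hf g₁
    obtain ⟨a, rfl⟩ := mk_surjective n
    rw [← LieHom.map_lie]
    simp only [lie_mk]
    rw [← mk_add, leibniz_lie]

instance instLieModule : LieModule k G (IdealAb f hf J hJ) where
  smul_lie c g n := by
    obtain ⟨l, rfl⟩ := hf g
    obtain ⟨a, rfl⟩ := mk_surjective n
    rw [← map_smul, lie_mk, lie_mk, smul_lie, mk_smul]
  lie_smul c g n := by
    obtain ⟨l, rfl⟩ := hf g
    obtain ⟨a, rfl⟩ := mk_surjective n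
    rw [← mk_smul, lie_mk, lie_mk, lie_smul, mk_smul]

end IdealAb

end Modules

section Ext

variable {k L : Type u} [Field k] [LieRing L] [LieAlgebra k L]

attribute [local instance 100] LieRing.ofAssociativeRing

/-- A representation `V` of a Lie algebra `L`, as a module over its universal enveloping algebra:
`l ∈ L` acts by `v ↦ ⁅l, v⁆`. -/
noncomputable def repModule (k L : Type u) [Field k] [LieRing L] [LieAlgebra k L]
    (V : Type u) [AddCommGroup V] [Module k V] [LieRingModule L V] [LieModule k L V] :
    ModuleCat.{u} (UniversalEnvelopingAlgebra k L) :=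
  letI : Module (UniversalEnvelopingAlgebra k L) V :=
    Module.compHom V (UniversalEnvelopingAlgebra.lift k (LieModule.toEnd k L V)).toRingHom
  ModuleCat.of (UniversalEnvelopingAlgebra k L) V

theorem ι_smul_repModule (V : Type u) [AddCommGroup V] [Module k V] [LieRingModule L V]
    [LieModule k L V] (l : L) (v : V) :
    (UniversalEnvelopingAlgebra.ι k l • (show repModule k L V from v) : repModule k L V) =
      (show repModule k L V from (⁅l, v⁆ : V)) := by
  change (UniversalEnvelopingAlgebra.lift k (LieModule.toEnd k L V))
    (UniversalEnvelopingAlgebra.ι k l) v = ⁅l, v⁆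
  rw [UniversalEnvelopingAlgebra.lift_ι_apply]
  rfl

/-- `Ext¹_L(V, W)` for representations `V` and `W` of a Lie algebra `L`: the first extension
group in the abelian category of representations of `L`, that is, of modules over the universal
enveloping algebra of `L`. It is a vector space over `k`. -/
abbrev ExtOne (k L : Type u) [Field k] [LieRing L] [LieAlgebra k L]
    (V W : Type u) [AddCommGroup V] [Module k V] [LieRingModule L V] [LieModule k L V]
    [AddCommGroup W] [Module k W] [LieRingModule L W] [LieModule k L W] : Type u :=
  CategoryTheory.Abelian.Ext.{u} (repModule k L V) (repModule k L W) 1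

end Ext

section Evaluation

variable {k A 𝔤 : Type u} {Γ : Type w} [Field k] [CommRing A] [Algebra k A]
  [LieRing 𝔤] [LieAlgebra k 𝔤] [Group Γ]
  (φ : Γ →* (A ≃ₐ[k] A)) (ψ : Γ →* (𝔤 ≃ₗ⁅k⁆ 𝔤))

/-- The evaluation representation `𝔐 → 𝔤^x → End V` attached to a representation `V` of `𝔤^x`:
the space `V`, on which `α ∈ 𝔐` acts by `α(x) ∈ 𝔤^x`. -/
def EvalRep (_φ : Γ →* (A ≃ₐ[k] A)) (_ψ : Γ →* (𝔤 ≃ₗ⁅k⁆ 𝔤)) (_x : A →ₐ[k] k) (V : Type u) :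
    Type u := V

namespace EvalRep

variable (x : A →ₐ[k] k) (V : Type u) [AddCommGroup V]

instance instAddCommGroup : AddCommGroup (EvalRep φ ψ x V) := inferInstanceAs (AddCommGroup V)

noncomputable instance instLieRingModule [LieRingModule (isotropyAlgebra φ ψ x) V] :
    LieRingModule (equivariantMapAlgebra φ ψ) (EvalRep φ ψ x V) :=
  LieRingModule.compLieHom V (ev φ ψ x)

theorem lie_def [LieRingModule (isotropyAlgebra φ ψ x) V] (α : equivariantMapAlgebra φ ψ)
    (v : V) : (⁅α, (show EvalRep φ ψ x V from v)⁆ : EvalRep φ ψ x V) =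
      (show EvalRep φ ψ x V from (⁅ev φ ψ x α, v⁆ : V)) := rfl

instance instModule [Module k V] : Module k (EvalRep φ ψ x V) := inferInstanceAs (Module k V)

instance instLieModule [Module k V] [LieRingModule (isotropyAlgebra φ ψ x) V]
    [LieModule k (isotropyAlgebra φ ψ x) V] :
    LieModule k (equivariantMapAlgebra φ ψ) (EvalRep φ ψ x V) :=
  LieModule.compLieHom V (ev φ ψ x)

end EvalRep

/-- The `𝔤^x`-module `𝔎_{x,ab}`. -/
abbrev KerAb [CharZero k] [Finite Γ] (x : A →ₐ[k] k) : Type u :=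
  IdealAb (ev φ ψ x) (ev_surjective φ ψ x) (kerEv φ ψ x) (ker_le_kerEv φ ψ x)

/-- The `𝔤^x`-module `ℨ_{x,ab}`. -/
abbrev CentAb [CharZero k] [Finite Γ] (x : A →ₐ[k] k) : Type u :=
  IdealAb (ev φ ψ x) (ev_surjective φ ψ x) (centEv φ ψ x) (ker_le_centEv φ ψ x)

end Evaluation

end EquivariantMap

open EquivariantMap

/-!
# First extension groups of evaluation representations of equivariant map algebras

For representations `V` and `V'` of a Lie algebra `L` with enveloping algebra `U`, the action map
`U ⊗ V → V` is a surjection from a free `U`-module whose kernel is generated by the elements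
`l ⊗ v - 1 ⊗ ⁅l, v⁆`. Restricting a `U`-linear map on the kernel to these generators gives exactly
the one-cocycles of `L` with values in `Hom(V, V')`, and the long exact sequence identifies
`Ext¹_L(V, V')` with `H¹(L, Hom(V, V'))` (`nonempty_extOne_equiv`).

Let `J` be an ideal of `L` acting trivially on `Hom(V, V')`. If `H¹` and `H²` of `L / J` with
coefficients in `Hom(V, V')` vanish, the inflation-restriction sequence identifies
`H¹(L, Hom(V, V'))` with the equivariant maps `J_ab → Hom(V, V') = V* ⊗ V'`
(`nonempty_extOne_equiv_hom`). This is applied to `L = 𝔐` in two ways.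

* If `λ ≠ λ'`, then `J = 𝔎_x`, so that `L / J = 𝔤^x`. Some central element of `𝔤^x` acts on
  `Hom(V, V')` by a nonzero scalar, and contracting with it kills the cohomology
  (`firstCohomologyVanishes_of_central`, `secondCohomologyVanishes_of_central`).
* If `λ = λ'`, the center of `𝔤^x` acts trivially on `Hom(V, V')`, and `J = ℨ_x` with
  `L / J = 𝔤^x_ss`. The cohomology vanishes by Whitehead's lemmas
  (`firstCohomologyVanishes_of_isKilling`, `secondCohomologyVanishes_of_isKilling`). The center also
  acts trivially on `ℨ_{x,ab}`, so equivariance under `𝔤^x` and under `𝔤^x_ss` are the same.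

The second case needs that `𝔤^x` is reductive (`hasCentralRadical_isotropyAlgebra`). The ideal
`[𝔤^x, rad 𝔤^x]` acts by zero on the irreducible constituents of the `𝔤^x`-module `𝔤`, so it is
orthogonal to `𝔤^x` under the Killing form of `𝔤`. Averaging over the finite group `Γ_x` shows that
it is orthogonal to all of `𝔤`, hence central in `𝔤`. It also lies in `[𝔤, 𝔤]`, so it is zero. The
splitting of a reductive Lie algebra into its center and its derived algebra comes from the Casimir
operator of its Killing form (`exists_casimir_projection`).
-/

namespace EquivariantMap

/-! ### One-cocycles and first extension groups -/

section Cocycles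

variable (k L M : Type*) [Field k] [LieRing L] [LieAlgebra k L] [AddCommGroup M] [Module k M]
  [LieRingModule L M] [LieModule k L M]

/-- The space `Z¹(L, M)` of one-cocycles (derivations) of a Lie algebra `L` with values in an
`L`-module `M`. -/
def oneCocycle : Submodule k (L →ₗ[k] M) := LinearMap.ker (LieModule.Cohomology.d₁₂ k L M)

variable {k L M}

theorem mem_oneCocycle {D : L →ₗ[k] M} :
    D ∈ oneCocycle k L M ↔ ∀ x y, D ⁅x, y⁆ = ⁅x, D y⁆ - ⁅y, D x⁆ := by
  rw [oneCocycle, LinearMap.mem_ker]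
  constructor
  · intro h x y
    have h₁ : LieModule.Cohomology.d₁₂ k L M D x y = 0 := by rw [h]; rfl
    rw [LieModule.Cohomology.d₁₂_apply_apply, sub_eq_zero] at h₁
    exact h₁.symm
  · intro h
    refine Subtype.ext (LinearMap.ext₂ fun x y => ?_)
    change LieModule.Cohomology.d₁₂ k L M D x y = 0
    rw [LieModule.Cohomology.d₁₂_apply_apply, h, sub_self]

end Cocycles

section FreeLift

variable {k U V W : Type*} [Field k] [Ring U] [Algebra k U] [AddCommGroup V] [Module k V]

/-- The `U`-linear map `U ⊗ V → W`, `u ⊗ v ↦ u • θ v` attached to a `k`-linear map `θ : V → W`. -/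
noncomputable def freeLift [AddCommGroup W] [Module k W] [Module U W] [IsScalarTower k U W]
    (θ : V →ₗ[k] W) : U ⊗[k] V →ₗ[U] W :=
  haveI : SMulCommClass k U W := IsScalarTower.to_smulCommClass
  TensorProduct.AlgebraTensorModule.lift (LinearMap.toSpanSingleton U (V →ₗ[k] W) θ)

theorem freeLift_tmul [AddCommGroup W] [Module k W] [Module U W] [IsScalarTower k U W]
    (θ : V →ₗ[k] W) (a : U) (v : V) :
    freeLift θ (a ⊗ₜ[k] v) = a • θ v := rfl

variable [Module U V] [IsScalarTower k U V]

variable (k U V) in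
/-- The action map `U ⊗ V → V`, a surjection from a projective `U`-module onto `V`. -/
noncomputable def actionMap : U ⊗[k] V →ₗ[U] V := freeLift LinearMap.id

theorem actionMap_tmul (a : U) (v : V) : actionMap k U V (a ⊗ₜ[k] v) = a • v := rfl

theorem actionMap_surjective : Function.Surjective (actionMap k U V) := fun v =>
  ⟨1 ⊗ₜ v, by rw [actionMap_tmul, one_smul]⟩

end FreeLift

section ExtPresentation

open CategoryTheory Abelian

variable {k U P V W : Type u} [Field k] [Ring U] [Algebra k U]
  [AddCommGroup V] [Module U V] [AddCommGroup P] [Module U P] [Module.Projective U P]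
  [AddCommGroup W] [Module k W] [Module U W] [IsScalarTower k U W] [SMulCommClass U k W]

/-- `Ext¹(V, W)` as the cokernel of `Hom(P, W) → Hom(Ker p, W)` for a surjection `p : P → V` from
a projective module. -/
theorem exists_connecting (p : P →ₗ[U] V) (hp : Function.Surjective p) :
    ∃ δ : (LinearMap.ker p →ₗ[U] W) →ₗ[k] Ext.{u} (ModuleCat.of U V) (ModuleCat.of U W) 1,
      Function.Surjective δ ∧
        ∀ g, δ g = 0 ↔ ∃ h : P →ₗ[U] W, g = h.comp (LinearMap.ker p).subtype := by
  have hS := LinearMap.shortExact_shortComplexKer hp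
  have : Projective (ModuleCat.of U P) := (IsProjective.iff_projective P).1 inferInstance
  have hP : ∀ e : Ext.{u} (ModuleCat.of U P) (ModuleCat.of U W) 1, e = 0 :=
    fun e => Ext.eq_zero_of_projective e
  let δ : (LinearMap.ker p →ₗ[U] W) →ₗ[k] Ext.{u} (ModuleCat.of U V) (ModuleCat.of U W) 1 :=
    { toFun := fun g => hS.extClass.comp (Ext.mk₀ (ModuleCat.ofHom g)) (add_zero 1)
      map_add' := fun g g₁ => by
        rw [ModuleCat.ofHom_add, Ext.mk₀_add, Ext.comp_add]
      map_smul' := fun c g => by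
        rw [RingHom.id_apply, ← Ext.comp_smul, ← Ext.mk₀_smul]
        congr 2
        ext n
        exact (algebraMap_smul U c (g n)).symm }
  refine ⟨δ, fun e => ?_, fun g => ⟨fun hg => ?_, ?_⟩⟩
  · obtain ⟨e₁, he₁⟩ := Ext.contravariant_sequence_exact₃ hS _ e (hP _) (add_zero 1)
    obtain ⟨g, rfl⟩ := Ext.addEquiv₀.symm.surjective e₁
    exact ⟨g.hom, he₁⟩
  · obtain ⟨e, he⟩ := Ext.contravariant_sequence_exact₁ hS _ _ (add_zero 1) hg
    obtain ⟨h, rfl⟩ := Ext.addEquiv₀.symm.surjective e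
    refine ⟨h.hom, ?_⟩
    have h₁ : Ext.mk₀ (p.shortComplexKer.f ≫ h) = Ext.mk₀ (ModuleCat.ofHom g) := by
      rw [← he, ← Ext.mk₀_comp_mk₀]
      rfl
    have h₂ := Ext.addEquiv₀.symm.injective h₁
    exact (congrArg ModuleCat.Hom.hom h₂).symm
  · rintro ⟨h, rfl⟩
    change hS.extClass.comp (Ext.mk₀ (p.shortComplexKer.f ≫ ModuleCat.ofHom h)) (add_zero 1) = 0
    rw [← Ext.mk₀_comp_mk₀, ← Ext.comp_assoc_of_second_deg_zero, hS.extClass_comp, Ext.zero_comp]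

end ExtPresentation

section Enveloping

attribute [local instance 100] LieRing.ofAssociativeRing

variable {k L : Type*} [Field k] [LieRing L] [LieAlgebra k L]

theorem enveloping_induction {C : UniversalEnvelopingAlgebra k L → Prop}
    (algebraMap : ∀ c, C (algebraMap k _ c)) (ι : ∀ l, C (UniversalEnvelopingAlgebra.ι k l))
    (mul : ∀ a b, C a → C b → C (a * b)) (add : ∀ a b, C a → C b → C (a + b))
    (a : UniversalEnvelopingAlgebra k L) : C a := by
  let S : Subalgebra k (UniversalEnvelopingAlgebra k L) :=
    { carrier := {a | C a}
      mul_mem' := fun {a b} => mul a b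
      add_mem' := fun {a b} => add a b
      algebraMap_mem' := algebraMap }
  let F : L →ₗ⁅k⁆ S :=
    { toFun := fun l => ⟨UniversalEnvelopingAlgebra.ι k l, ι l⟩
      map_add' := fun _ _ => Subtype.ext (map_add _ _ _)
      map_smul' := fun _ _ => Subtype.ext (map_smul _ _ _)
      map_lie' := fun {_ _} => Subtype.ext (LieHom.map_lie _ _ _) }
  have h : S.val.comp (UniversalEnvelopingAlgebra.lift k F) = AlgHom.id k _ := by
    refine UniversalEnvelopingAlgebra.hom_ext k (LieHom.ext fun l => ?_)
    change ((UniversalEnvelopingAlgebra.lift k F (UniversalEnvelopingAlgebra.ι k l) : S) :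
      UniversalEnvelopingAlgebra k L) = _
    rw [UniversalEnvelopingAlgebra.lift_ι_apply]
    rfl
  have h₁ := (UniversalEnvelopingAlgebra.lift k F a).2
  have h₂ : ((UniversalEnvelopingAlgebra.lift k F a : S) : UniversalEnvelopingAlgebra k L) = a :=
    AlgHom.congr_fun h a
  rwa [h₂] at h₁

local notation "𝒰(" k "," L ")" => UniversalEnvelopingAlgebra k L

variable {V W : Type*} [AddCommGroup V] [Module k V] [LieRingModule L V]
  [AddCommGroup W] [Module k W] [LieRingModule L W]

/-- The elements `l ⊗ v - 1 ⊗ ⁅l, v⁆`, which generate the kernel of the action map. -/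
noncomputable def actionRel (l : L) (v : V) : 𝒰(k,L) ⊗[k] V :=
  UniversalEnvelopingAlgebra.ι k l ⊗ₜ[k] v - 1 ⊗ₜ[k] ⁅l, v⁆

theorem freeLift_actionRel [Module 𝒰(k,L) W] [IsScalarTower k 𝒰(k,L) W]
    (hW : ∀ (l : L) (w : W), UniversalEnvelopingAlgebra.ι k l • w = ⁅l, w⁆)
    (θ : V →ₗ[k] W) (l : L) (v : V) :
    freeLift θ (actionRel l v) = ⁅l, θ v⁆ - θ ⁅l, v⁆ := by
  rw [actionRel, map_sub, freeLift_tmul, freeLift_tmul, one_smul, hW]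

theorem actionRel_mem_ker [Module 𝒰(k,L) V] [IsScalarTower k 𝒰(k,L) V]
    (hV : ∀ (l : L) (v : V), UniversalEnvelopingAlgebra.ι k l • v = ⁅l, v⁆) (l : L) (v : V) :
    actionRel l v ∈ LinearMap.ker (actionMap k 𝒰(k,L) V) := by
  rw [LinearMap.mem_ker, actionMap, freeLift_actionRel hV]
  exact sub_self _

/-- Modulo the submodule generated by the elements `actionRel l v`, every element of `U ⊗ V` is
of the form `1 ⊗ v`. -/
theorem sub_tmul_actionMap_mem [Module 𝒰(k,L) V] [IsScalarTower k 𝒰(k,L) V]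
    (hV : ∀ (l : L) (v : V), UniversalEnvelopingAlgebra.ι k l • v = ⁅l, v⁆)
    (S : Submodule 𝒰(k,L) (𝒰(k,L) ⊗[k] V)) (hS : ∀ (l : L) (v : V), actionRel l v ∈ S)
    (p : 𝒰(k,L) ⊗[k] V) :
    p - 1 ⊗ₜ[k] actionMap k 𝒰(k,L) V p ∈ S := by
  have key : ∀ (a : 𝒰(k,L)) (v : V), a ⊗ₜ[k] v - 1 ⊗ₜ[k] (a • v) ∈ S := by
    intro a
    induction a using enveloping_induction with
    | algebraMap c =>
      intro v
      rw [algebraMap_smul, TensorProduct.tmul_smul, TensorProduct.smul_tmul',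
        Algebra.algebraMap_eq_smul_one, sub_self]
      exact S.zero_mem
    | ι l =>
      intro v
      rw [hV]
      exact hS l v
    | mul a b ha hb =>
      intro v
      have h := S.add_mem (S.smul_mem a (hb v)) (ha (b • v))
      rwa [smul_sub, TensorProduct.smul_tmul', TensorProduct.smul_tmul', smul_eq_mul, smul_eq_mul,
        mul_one, sub_add_sub_cancel, smul_smul] at h
    | add a b ha hb =>
      intro v
      have h := S.add_mem (ha v) (hb v)
      rwa [← add_sub_add_comm, ← TensorProduct.add_tmul, ← TensorProduct.tmul_add,
        ← add_smul] at h
  induction p with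
  | zero => simp
  | tmul a v => exact key a v
  | add p q hp hq =>
    rw [map_add, TensorProduct.tmul_add, add_sub_add_comm]
    exact S.add_mem hp hq

/-- A linear map on the kernel of the action map is determined by its values on the generators. -/
theorem eq_zero_of_actionRel {W : Type*} [AddCommGroup W] [Module 𝒰(k,L) W]
    [Module 𝒰(k,L) V] [IsScalarTower k 𝒰(k,L) V]
    (hV : ∀ (l : L) (v : V), UniversalEnvelopingAlgebra.ι k l • v = ⁅l, v⁆)
    (g : LinearMap.ker (actionMap k 𝒰(k,L) V) →ₗ[𝒰(k,L)] W)
    (hg : ∀ l v, g ⟨actionRel l v, actionRel_mem_ker hV l v⟩ = 0) : g = 0 := by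
  refine LinearMap.ext fun n => ?_
  have h := sub_tmul_actionMap_mem hV ((LinearMap.ker g).map (LinearMap.ker _).subtype)
    (fun l v => ⟨_, hg l v, rfl⟩) n
  rw [LinearMap.mem_ker.1 n.2, TensorProduct.tmul_zero, sub_zero] at h
  obtain ⟨m, hm, hmn⟩ := h
  rw [← Subtype.ext hmn]
  exact hm

section CocycleOfHom

set_option linter.unusedSectionVars false

variable [LieModule k L V] [LieModule k L W]
  [Module 𝒰(k,L) V] [IsScalarTower k 𝒰(k,L) V] [Module 𝒰(k,L) W] [IsScalarTower k 𝒰(k,L) W]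
  (hV : ∀ (l : L) (v : V), UniversalEnvelopingAlgebra.ι k l • v = ⁅l, v⁆)

/-- The one-cochain `l ↦ (v ↦ g (l ⊗ v - 1 ⊗ ⁅l, v⁆))` attached to a linear map `g` on the kernel
of the action map. -/
noncomputable def cochainOfHom [SMulCommClass 𝒰(k,L) k W] :
    (LinearMap.ker (actionMap k 𝒰(k,L) V) →ₗ[𝒰(k,L)] W) →ₗ[k] L →ₗ[k] V →ₗ[k] W where
  toFun g := LinearMap.mk₂ k (fun l v => g ⟨actionRel l v, actionRel_mem_ker hV l v⟩)
    (fun l₁ l₂ v => by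
      rw [← map_add]
      congr 1
      refine Subtype.ext ?_
      simp only [actionRel, map_add, add_lie, TensorProduct.add_tmul, TensorProduct.tmul_add,
        Submodule.coe_add]
      abel)
    (fun c l v => by
      rw [← algebraMap_smul 𝒰(k,L) c (g _), ← map_smul]
      congr 1
      refine Subtype.ext ?_
      change actionRel (c • l) v = algebraMap k _ c • actionRel l v
      simp only [actionRel, map_smul, smul_lie, TensorProduct.tmul_smul, algebraMap_smul,
        smul_sub, TensorProduct.smul_tmul'])
    (fun l v₁ v₂ => by
      rw [← map_add]
      congr 1
      refine Subtype.ext ?_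
      simp only [actionRel, lie_add, TensorProduct.tmul_add, Submodule.coe_add]
      abel)
    (fun c l v => by
      rw [← algebraMap_smul 𝒰(k,L) c (g _), ← map_smul]
      congr 1
      refine Subtype.ext ?_
      change actionRel l (c • v) = algebraMap k _ c • actionRel l v
      simp only [actionRel, lie_smul, TensorProduct.tmul_smul, algebraMap_smul, smul_sub])
  map_add' _ _ := rfl
  map_smul' _ _ := rfl

theorem cochainOfHom_apply [SMulCommClass 𝒰(k,L) k W]
    (g : LinearMap.ker (actionMap k 𝒰(k,L) V) →ₗ[𝒰(k,L)] W)
    (l : L) (v : V) :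
    cochainOfHom hV g l v = g ⟨actionRel l v, actionRel_mem_ker hV l v⟩ := rfl

theorem cochainOfHom_mem [SMulCommClass 𝒰(k,L) k W]
    (hW : ∀ (l : L) (w : W), UniversalEnvelopingAlgebra.ι k l • w = ⁅l, w⁆)
    (g : LinearMap.ker (actionMap k 𝒰(k,L) V) →ₗ[𝒰(k,L)] W) :
    cochainOfHom hV g ∈ oneCocycle k L (V →ₗ[k] W) := by
  rw [mem_oneCocycle]
  intro x y
  refine LinearMap.ext fun v => ?_
  simp only [LinearMap.sub_apply, LieHom.lie_apply, cochainOfHom_apply, ← hW, ← map_smul,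
    ← map_sub]
  congr 1
  refine Subtype.ext ?_
  simp only [actionRel, LieHom.map_lie, LieRing.of_associative_ring_bracket, lie_lie,
    Submodule.coe_sub, Submodule.coe_smul, smul_sub, TensorProduct.smul_tmul', smul_eq_mul, mul_one,
    TensorProduct.sub_tmul, TensorProduct.tmul_sub]
  abel

/-- The cochain of `g` is a coboundary if and only if `g` extends to `U ⊗ V`. -/
theorem cochainOfHom_eq_coboundary [SMulCommClass 𝒰(k,L) k W]
    (hW : ∀ (l : L) (w : W), UniversalEnvelopingAlgebra.ι k l • w = ⁅l, w⁆)
    (g : LinearMap.ker (actionMap k 𝒰(k,L) V) →ₗ[𝒰(k,L)] W) :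
    (∃ θ : V →ₗ[k] W, ∀ l, cochainOfHom hV g l = ⁅l, θ⁆) ↔
      ∃ h : 𝒰(k,L) ⊗[k] V →ₗ[𝒰(k,L)] W,
        g = h.comp (LinearMap.ker (actionMap k 𝒰(k,L) V)).subtype := by
  constructor
  · rintro ⟨θ, hθ⟩
    refine ⟨freeLift θ, sub_eq_zero.1 (eq_zero_of_actionRel hV _ fun l v => ?_)⟩
    rw [LinearMap.sub_apply, ← cochainOfHom_apply hV, hθ, LieHom.lie_apply, sub_eq_zero]
    exact (freeLift_actionRel hW θ l v).symm
  · rintro ⟨h, rfl⟩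
    refine ⟨(h.restrictScalars k).comp (TensorProduct.mk k 𝒰(k,L) V 1), fun l => ?_⟩
    refine LinearMap.ext fun v => ?_
    rw [cochainOfHom_apply, LieHom.lie_apply]
    change h (actionRel l v) = ⁅l, h (1 ⊗ₜ v)⁆ - h (1 ⊗ₜ ⁅l, v⁆)
    rw [actionRel, map_sub, ← hW, ← map_smul, TensorProduct.smul_tmul', smul_eq_mul, mul_one]

/-- Every one-cocycle `D` comes from the extension `W ⊕ V` on which `l` acts by
`(w, v) ↦ (⁅l, w⁆ + D l v, ⁅l, v⁆)`. -/
theorem exists_cochainOfHom_eq [SMulCommClass 𝒰(k,L) k W]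
    (hW : ∀ (l : L) (w : W), UniversalEnvelopingAlgebra.ι k l • w = ⁅l, w⁆)
    (D : L →ₗ[k] V →ₗ[k] W)
    (hD : D ∈ oneCocycle k L (V →ₗ[k] W)) :
    ∃ g : LinearMap.ker (actionMap k 𝒰(k,L) V) →ₗ[𝒰(k,L)] W, cochainOfHom hV g = D := by
  rw [mem_oneCocycle] at hD
  let ρ : L →ₗ⁅k⁆ Module.End k (W × V) :=
    { toFun := fun l => ((LieModule.toEnd k L W l).comp (LinearMap.fst k W V) +
        (D l).comp (LinearMap.snd k W V)).prod
          ((LieModule.toEnd k L V l).comp (LinearMap.snd k W V))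
      map_add' := fun x y => by
        refine LinearMap.ext fun p => Prod.ext ?_ ?_
        · simp; abel
        · simp
      map_smul' := fun c x => by
        refine LinearMap.ext fun p => Prod.ext ?_ ?_ <;> simp
      map_lie' := fun {x y} => by
        refine LinearMap.ext fun p => Prod.ext ?_ ?_
        · simp [LieRing.of_associative_ring_bracket, hD]; abel
        · simp [LieRing.of_associative_ring_bracket] }
  let F := UniversalEnvelopingAlgebra.lift k ρ
  have hF : ∀ l p, F (UniversalEnvelopingAlgebra.ι k l) p = (⁅l, p.1⁆ + D l p.2, ⁅l, p.2⁆) := by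
    intro l p
    rw [UniversalEnvelopingAlgebra.lift_ι_apply]
    rfl
  have hsnd : ∀ (a : 𝒰(k,L)) (p : W × V), (F a p).2 = a • p.2 := by
    intro a
    induction a using enveloping_induction with
    | algebraMap c => intro p; simp
    | ι l => intro p; rw [hF, hV]
    | mul a b ha hb => intro p; rw [map_mul, Module.End.mul_apply, ha, hb, mul_smul]
    | add a b ha hb => intro p; rw [map_add, LinearMap.add_apply, Prod.snd_add, ha, hb, add_smul]
  have hfst : ∀ (a : 𝒰(k,L)) (w : W), F a (w, 0) = (a • w, 0) := by
    intro a
    induction a using enveloping_induction with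
    | algebraMap c => intro w; simp
    | ι l => intro w; rw [hF, hW]; simp
    | mul a b ha hb => intro w; rw [map_mul, Module.End.mul_apply, hb, ha, mul_smul]
    | add a b ha hb => intro w; rw [map_add, LinearMap.add_apply, ha, hb, add_smul]; simp
  let G : 𝒰(k,L) ⊗[k] V →ₗ[k] W × V :=
    TensorProduct.lift ((LinearMap.llcomp k V (W × V) (W × V)).flip (LinearMap.inr k W V) ∘ₗ
      F.toLinearMap)
  have hG : ∀ a v, G (a ⊗ₜ v) = F a (0, v) := fun a v => rfl
  have hGsmul : ∀ (a : 𝒰(k,L)) p, G (a • p) = F a (G p) := by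
    intro a p
    induction p with
    | zero => simp
    | tmul b v => rw [TensorProduct.smul_tmul', hG, hG, smul_eq_mul, map_mul, Module.End.mul_apply]
    | add p q hp hq => rw [smul_add, map_add, map_add, map_add, hp, hq]
  have hGsnd : ∀ p, (G p).2 = actionMap k 𝒰(k,L) V p := by
    intro p
    induction p with
    | zero => simp
    | tmul b v => rw [hG, hsnd, actionMap_tmul]
    | add p q hp hq => rw [map_add, map_add, Prod.snd_add, hp, hq]
  refine ⟨{ toFun := fun n => (G n).1
            map_add' := fun n m => by rw [Submodule.coe_add, map_add, Prod.fst_add]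
            map_smul' := fun a n => ?_ }, ?_⟩
  · have h : G n = ((G n).1, 0) := Prod.ext rfl ((hGsnd n).trans (LinearMap.mem_ker.1 n.2))
    rw [Submodule.coe_smul, hGsmul, h, hfst, RingHom.id_apply]
  · refine LinearMap.ext₂ fun l v => ?_
    rw [cochainOfHom_apply]
    change (G (actionRel l v)).1 = D l v
    rw [actionRel, map_sub, hG, hG, hF, map_one]
    simp

end CocycleOfHom

end Enveloping

section ExtOne

variable {k L V W : Type u} [Field k] [LieRing L] [LieAlgebra k L]
  [AddCommGroup V] [Module k V] [LieRingModule L V] [LieModule k L V]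
  [AddCommGroup W] [Module k W] [LieRingModule L W] [LieModule k L W]

attribute [local instance 100] LieRing.ofAssociativeRing

/-- `Ext¹(V, W)` is `H¹(L, Hom(V, W))`, the quotient of the space of one-cocycles by the
one-coboundaries. -/
theorem nonempty_extOne_equiv {T : Type*} [AddCommGroup T] [Module k T]
    (Ψ : oneCocycle k L (V →ₗ[k] W) →ₗ[k] T) (hsurj : Function.Surjective Ψ)
    (hker : ∀ D, Ψ D = 0 ↔ ∃ θ : V →ₗ[k] W, ∀ l, D.1 l = ⁅l, θ⁆) :
    Nonempty (ExtOne k L V W ≃ₗ[k] T) := by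
  let : Module (UniversalEnvelopingAlgebra k L) V :=
    Module.compHom V (UniversalEnvelopingAlgebra.lift k (LieModule.toEnd k L V)).toRingHom
  let : Module (UniversalEnvelopingAlgebra k L) W :=
    Module.compHom W (UniversalEnvelopingAlgebra.lift k (LieModule.toEnd k L W)).toRingHom
  have hsV : ∀ (a : UniversalEnvelopingAlgebra k L) (v : V),
    a • v = UniversalEnvelopingAlgebra.lift k (LieModule.toEnd k L V) a v := fun _ _ => rfl
  have hsW : ∀ (a : UniversalEnvelopingAlgebra k L) (v : W),
    a • v = UniversalEnvelopingAlgebra.lift k (LieModule.toEnd k L W) a v := fun _ _ => rfl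
  have : IsScalarTower k (UniversalEnvelopingAlgebra k L) V := ⟨fun c a v => by
    rw [hsV, hsV, map_smul, LinearMap.smul_apply]⟩
  have : IsScalarTower k (UniversalEnvelopingAlgebra k L) W := ⟨fun c a v => by
    rw [hsW, hsW, map_smul, LinearMap.smul_apply]⟩
  have : SMulCommClass (UniversalEnvelopingAlgebra k L) k W := ⟨fun a c v => by
    rw [hsW, hsW, map_smul]⟩
  have hV : ∀ (l : L) (v : V), UniversalEnvelopingAlgebra.ι k l • v = ⁅l, v⁆ :=
    fun l v => ι_smul_repModule V l v
  have hW : ∀ (l : L) (v : W), UniversalEnvelopingAlgebra.ι k l • v = ⁅l, v⁆ :=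
    fun l v => ι_smul_repModule W l v
  obtain ⟨δ, hδ, hδ₀⟩ := exists_connecting (k := k) (W := W)
    (actionMap k (UniversalEnvelopingAlgebra k L) V) actionMap_surjective
  let Θ := Ψ ∘ₗ (cochainOfHom hV).codRestrict _ (cochainOfHom_mem (W := W) hV hW)
  have hΘ : Function.Surjective Θ := by
    intro t
    obtain ⟨⟨D, hD⟩, rfl⟩ := hsurj t
    obtain ⟨g, hg⟩ := exists_cochainOfHom_eq hV hW D hD
    exact ⟨g, congrArg Ψ (Subtype.ext hg)⟩
  have hk : LinearMap.ker δ = LinearMap.ker Θ := by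
    ext g
    rw [LinearMap.mem_ker, LinearMap.mem_ker, hδ₀, ← cochainOfHom_eq_coboundary hV hW]
    exact (hker ⟨_, cochainOfHom_mem hV hW g⟩).symm
  exact ⟨(δ.quotKerEquivOfSurjective hδ).symm ≪≫ₗ Submodule.quotEquivOfEq _ _ hk ≪≫ₗ
    Θ.quotKerEquivOfSurjective hΘ⟩

end ExtOne

/-! ### Vanishing of the first and second cohomology -/

section Vanishing

variable (k L M : Type*) [Field k] [LieRing L] [LieAlgebra k L] [AddCommGroup M] [Module k M]
  [LieRingModule L M]

variable {k L M} in
/-- An alternating bilinear map `ω : L × L → M` with `d ω = 0`. -/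
structure IsTwoCocycle (ω : L →ₗ[k] L →ₗ[k] M) : Prop where
  alt : ∀ x, ω x x = 0
  cocycle : ∀ x y z, ⁅x, ω y z⁆ - ⁅y, ω x z⁆ + ⁅z, ω x y⁆ -
    ω ⁅x, y⁆ z + ω ⁅x, z⁆ y - ω ⁅y, z⁆ x = 0

/-- `H²(L, M) = 0`: every two-cocycle is a coboundary. -/
def SecondCohomologyVanishes : Prop :=
  ∀ ω : L →ₗ[k] L →ₗ[k] M, IsTwoCocycle ω →
    ∃ η : L →ₗ[k] M, ∀ x y, ω x y = ⁅x, η y⁆ - ⁅y, η x⁆ - η ⁅x, y⁆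

variable {k L M}

theorem IsTwoCocycle.skew {ω : L →ₗ[k] L →ₗ[k] M} (hω : IsTwoCocycle ω) (x y : L) :
    ω x y = -ω y x := by
  have h := hω.alt (x + y)
  simp only [map_add, LinearMap.add_apply, hω.alt, zero_add, add_zero] at h
  exact eq_neg_of_add_eq_zero_right h

theorem IsTwoCocycle.sub {ω ω' : L →ₗ[k] L →ₗ[k] M} (hω : IsTwoCocycle ω)
    (hω' : IsTwoCocycle ω') : IsTwoCocycle (ω - ω') where
  alt x := by simp [hω.alt, hω'.alt]
  cocycle x y z := by
    have h := hω.cocycle x y z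
    have h' := hω'.cocycle x y z
    simp only [LinearMap.sub_apply, lie_sub]
    rw [← sub_eq_zero.2 (h.trans h'.symm)]
    abel

variable [LieModule k L M]

variable (k L M) in
/-- `H¹(L, M) = 0`: every one-cocycle is a coboundary. -/
def FirstCohomologyVanishes : Prop :=
  ∀ D ∈ oneCocycle k L M, ∃ m : M, ∀ x, D x = ⁅x, m⁆

theorem isTwoCocycle_d (η : L →ₗ[k] M) :
    IsTwoCocycle (LieModule.Cohomology.d₁₂ k L M η).1 where
  alt x := LieModule.Cohomology.twoCochain_alt _ x
  cocycle x y z := by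
    have h := LinearMap.congr_fun (LieModule.Cohomology.d₂₃_comp_d₁₂ k L M) η
    exact LinearMap.congr_fun (LinearMap.congr_fun₂ h x y) z

/-- A central element acting by a nonzero scalar makes the cohomology vanish: contraction with it is
a homotopy. -/
theorem firstCohomologyVanishes_of_central {z : L} (hz : ∀ x : L, ⁅z, x⁆ = 0) {c : k} (hc : c ≠ 0)
    (hzc : ∀ m : M, ⁅z, m⁆ = c • m) : FirstCohomologyVanishes k L M := by
  intro D hD
  refine ⟨c⁻¹ • D z, fun x => ?_⟩
  have h := mem_oneCocycle.1 hD z x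
  rw [hz, map_zero, hzc] at h
  rw [lie_smul, ← sub_eq_zero.1 h.symm, smul_smul, inv_mul_cancel₀ hc, one_smul]

theorem secondCohomologyVanishes_of_central {z : L} (hz : ∀ x : L, ⁅z, x⁆ = 0) {c : k} (hc : c ≠ 0)
    (hzc : ∀ m : M, ⁅z, m⁆ = c • m) : SecondCohomologyVanishes k L M := by
  intro ω hω
  refine ⟨c⁻¹ • ω z, fun x y => ?_⟩
  have h := hω.cocycle z x y
  rw [hz, hz, hzc, map_zero, LinearMap.zero_apply, LinearMap.zero_apply, sub_zero, add_zero,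
    hω.skew ⁅x, y⁆ z] at h
  have h₁ : c • ω x y = ⁅x, ω z y⁆ - ⁅y, ω z x⁆ - ω z ⁅x, y⁆ := by
    rw [← sub_eq_zero, ← h]
    abel
  rw [LinearMap.smul_apply, LinearMap.smul_apply, LinearMap.smul_apply, lie_smul, lie_smul,
    ← smul_sub, ← smul_sub, ← h₁, smul_smul, inv_mul_cancel₀ hc, one_smul]

/-- If the outer terms of `0 → N → M → M / N → 0` have vanishing `H¹`, so has `M`. -/
theorem firstCohomologyVanishes_of_quotient (N : LieSubmodule k L M)
    (h : FirstCohomologyVanishes k L N) (h' : FirstCohomologyVanishes k L (M ⧸ N)) :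
    FirstCohomologyVanishes k L M := by
  intro D hD
  rw [mem_oneCocycle] at hD
  obtain ⟨m', hm'⟩ := h' ((LieSubmodule.Quotient.mk' N : M →ₗ[k] M ⧸ N) ∘ₗ D)
    (mem_oneCocycle.2 fun x y => by
      change LieSubmodule.Quotient.mk' N (D ⁅x, y⁆) =
        ⁅x, LieSubmodule.Quotient.mk' N (D y)⁆ - ⁅y, LieSubmodule.Quotient.mk' N (D x)⁆
      rw [hD, map_sub, LieModuleHom.map_lie, LieModuleHom.map_lie])
  obtain ⟨m, rfl⟩ := LieSubmodule.Quotient.surjective_mk' N m'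
  have hmem : ∀ x, D x - ⁅x, m⁆ ∈ N := by
    intro x
    rw [← LieSubmodule.Quotient.mk_eq_zero, map_sub, LieModuleHom.map_lie, sub_eq_zero]
    exact hm' x
  let D' : L →ₗ[k] N := (D - (LieModule.toEnd k L M : L →ₗ[k] Module.End k M).flip m).codRestrict
    N.toSubmodule hmem
  have hD' : ∀ x, (D' x : M) = D x - ⁅x, m⁆ := fun _ => rfl
  obtain ⟨n, hn⟩ := h D' (mem_oneCocycle.2 fun x y => Subtype.ext (by
    simp only [LieSubmodule.coe_sub, LieSubmodule.coe_bracket, hD', hD, lie_sub, lie_lie]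
    abel))
  refine ⟨m + n, fun x => ?_⟩
  have h₁ := hD' x
  rw [hn, LieSubmodule.coe_bracket] at h₁
  rw [lie_add, h₁]
  abel

/-- If the outer terms of `0 → N → M → M / N → 0` have vanishing `H²`, so has `M`. -/
theorem secondCohomologyVanishes_of_quotient (N : LieSubmodule k L M)
    (h : SecondCohomologyVanishes k L N) (h' : SecondCohomologyVanishes k L (M ⧸ N)) :
    SecondCohomologyVanishes k L M := by
  intro ω hω
  obtain ⟨η', hη'⟩ := h' (ω.compr₂ (LieSubmodule.Quotient.mk' N : M →ₗ[k] M ⧸ N))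
    { alt := fun x => by
        change LieSubmodule.Quotient.mk' N (ω x x) = 0
        rw [hω.alt, map_zero]
      cocycle := fun x y z => by
        have h₁ := congrArg (LieSubmodule.Quotient.mk' N) (hω.cocycle x y z)
        simp only [map_sub, map_add, LieModuleHom.map_lie, map_zero] at h₁
        exact h₁ }
  obtain ⟨η, hη⟩ := Module.projective_lifting_property
    (LieSubmodule.Quotient.mk' N : M →ₗ[k] M ⧸ N) η' (LieSubmodule.Quotient.surjective_mk' N)
  have hη₁ : ∀ x, LieSubmodule.Quotient.mk' N (η x) = η' x := LinearMap.congr_fun hη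
  have hωη := hω.sub (isTwoCocycle_d η)
  set ω' := ω - (LieModule.Cohomology.d₁₂ k L M η).1 with hω'
  have hω'₁ : ∀ x y, ω' x y = ω x y - (⁅x, η y⁆ - ⁅y, η x⁆ - η ⁅x, y⁆) := fun x y => rfl
  have hmem : ∀ x y, ω' x y ∈ N := by
    intro x y
    rw [← LieSubmodule.Quotient.mk_eq_zero, hω'₁, map_sub, sub_eq_zero]
    simp only [map_sub, LieModuleHom.map_lie, hη₁]
    exact hη' x y
  let ω₁ : L →ₗ[k] L →ₗ[k] N := LinearMap.mk₂ k (fun x y => ⟨ω' x y, hmem x y⟩)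
    (fun _ _ _ => Subtype.ext (by simp)) (fun _ _ _ => Subtype.ext (by simp))
    (fun _ _ _ => Subtype.ext (by simp)) (fun _ _ _ => Subtype.ext (by simp))
  have hω₁ : ∀ x y, (ω₁ x y : M) = ω' x y := fun _ _ => rfl
  obtain ⟨θ, hθ⟩ := h ω₁
    { alt := fun x => Subtype.ext (hωη.alt x)
      cocycle := fun x y z => Subtype.ext (by
        simpa only [LieSubmodule.coe_sub, LieSubmodule.coe_add, LieSubmodule.coe_bracket, hω₁,
          LieSubmodule.coe_zero] using hωη.cocycle x y z) }
  refine ⟨η + (N.incl : N →ₗ[k] M) ∘ₗ θ, fun x y => ?_⟩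
  have h₁ := congrArg (Subtype.val) (hθ x y)
  simp only [hω₁, hω'₁, LieSubmodule.coe_sub, LieSubmodule.coe_bracket] at h₁
  have h₂ : ∀ x, (η + (N.incl : N →ₗ[k] M) ∘ₗ θ) x = η x + θ x := fun _ => rfl
  rw [sub_eq_iff_eq_add] at h₁
  simp only [h₂, lie_add, h₁]
  abel

end Vanishing

section Induction

universe v

variable {k L : Type*} [Field k] [LieRing L] [LieAlgebra k L]

/-- Induction on the length of a finite-dimensional Lie module. -/
theorem lieModule_induction
    {P : ∀ (M : Type v) [AddCommGroup M] [Module k M] [LieRingModule L M] [LieModule k L M], Prop}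
    (subsingleton : ∀ (M : Type v) [AddCommGroup M] [Module k M] [LieRingModule L M]
      [LieModule k L M], Subsingleton M → P M)
    (irreducible : ∀ (M : Type v) [AddCommGroup M] [Module k M] [LieRingModule L M]
      [LieModule k L M] [FiniteDimensional k M], LieModule.IsIrreducible k L M → P M)
    (extension : ∀ (M : Type v) [AddCommGroup M] [Module k M] [LieRingModule L M]
      [LieModule k L M] (N : LieSubmodule k L M), P N → P (M ⧸ N) → P M)
    (M : Type v) [AddCommGroup M] [Module k M] [LieRingModule L M] [LieModule k L M]
    [FiniteDimensional k M] : P M := by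
  suffices H : ∀ (n : ℕ) (M : Type v) [AddCommGroup M] [Module k M] [LieRingModule L M]
      [LieModule k L M] [FiniteDimensional k M], Module.finrank k M = n → P M from H _ M rfl
  intro n
  induction n using Nat.strong_induction_on with
  | _ n ih =>
    intro M _ _ _ _ _ hn
    by_cases hM : Subsingleton M
    · exact subsingleton M hM
    rw [not_subsingleton_iff_nontrivial] at hM
    by_cases hirr : ∀ N : LieSubmodule k L M, N ≠ ⊥ → N = ⊤
    · exact irreducible M (LieModule.IsIrreducible.mk hirr)
    push Not at hirr
    obtain ⟨N, hbot, htop⟩ := hirr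
    have hbot' : N.toSubmodule ≠ ⊥ := fun h => hbot ((LieSubmodule.toSubmodule_eq_bot N).1 h)
    have htop' : N.toSubmodule ≠ ⊤ := fun h => htop ((LieSubmodule.toSubmodule_eq_top N).1 h)
    have h₁ : Module.finrank k (M ⧸ N.toSubmodule) + Module.finrank k N.toSubmodule =
      Module.finrank k M := Submodule.finrank_quotient_add_finrank _
    have h₂ : Module.finrank k N.toSubmodule < Module.finrank k M := Submodule.finrank_lt htop'
    have h₃ : Module.finrank k N.toSubmodule ≠ 0 := fun h =>
      hbot' (Submodule.finrank_eq_zero.1 h)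
    have : FiniteDimensional k (M ⧸ N) := inferInstanceAs (FiniteDimensional k (M ⧸ N.toSubmodule))
    exact extension M N (ih _ (hn ▸ h₂) N rfl)
      (ih (Module.finrank k (M ⧸ N.toSubmodule)) (by omega) (M ⧸ N) rfl)

end Induction

/-! ### Casimir operators and the Whitehead lemmas -/

section Casimir

variable {k L N : Type*} [Field k] [LieRing L] [LieAlgebra k L] [AddCommGroup N] [Module k N]

/-- The Casimir tensor `∑ eᵢ ⊗ fᵢ` of an invariant form `B` is invariant. The families `e` and `f`
need only be dual to each other in the eyes of the bilinear map `β` to which they are fed. -/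
theorem casimir_invariant {ι : Type*} [Fintype ι] (B : LinearMap.BilinForm k L)
    (hB : ∀ x y z : L, B ⁅x, y⁆ z = -B y ⁅x, z⁆) (hsymm : ∀ x y, B x y = B y x)
    (e f : ι → L) (x : L)
    (β : L →ₗ[k] L →ₗ[k] N)
    (he : ∀ i y, β ⁅x, e i⁆ y = ∑ j, B ⁅x, e i⁆ (f j) • β (e j) y)
    (hf : ∀ i y, β y ⁅x, f i⁆ = ∑ j, B ⁅x, f i⁆ (e j) • β y (f j)) :
    ∑ i, (β ⁅x, e i⁆ (f i) + β (e i) ⁅x, f i⁆) = 0 := by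
  simp only [he, hf, Finset.sum_add_distrib]
  rw [Finset.sum_comm, ← Finset.sum_add_distrib]
  refine Finset.sum_eq_zero fun i _ => ?_
  rw [← Finset.sum_add_distrib]
  refine Finset.sum_eq_zero fun j _ => ?_
  rw [← add_smul, hB, hsymm (e j), neg_add_cancel, zero_smul]

/-- Dual bases, inside a subspace `S`, for a symmetric form that is nondegenerate on `S`. -/
theorem exists_dual_families {V : Type*} [AddCommGroup V] [Module k V]
    (B : LinearMap.BilinForm k V) (hsymm : ∀ x y, B x y = B y x) (S : Submodule k V)
    [FiniteDimensional k S] (hS : ∀ x ∈ S, (∀ y ∈ S, B x y = 0) → x = 0) :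
    ∃ e f : Fin (Module.finrank k S) → V, (∀ i, e i ∈ S) ∧ (∀ i, f i ∈ S) ∧
      (∀ y ∈ S, y = ∑ j, B y (f j) • e j) ∧ (∀ y ∈ S, y = ∑ j, B y (e j) • f j) ∧
      ∀ i, B (f i) (e i) = 1 := by
  have hBS : (B.restrict S).IsSymm := ⟨fun a b => hsymm a b⟩
  have hnd : (B.restrict S).Nondegenerate :=
    hBS.isRefl.nondegenerate_iff_separatingLeft.2 fun a ha =>
      Subtype.ext (hS a a.2 fun y hy => ha ⟨y, hy⟩)
  let b := Module.finBasis k S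
  let b' := LinearMap.BilinForm.dualBasis (B.restrict S) hnd b
  refine ⟨fun i => b i, fun i => b' i, fun i => (b i).2, fun i => (b' i).2, fun y hy => ?_,
    fun y hy => ?_, fun i => ?_⟩
  · have h := congrArg S.subtype (b.sum_repr ⟨y, hy⟩)
    rw [map_sum] at h
    refine h.symm.trans (Finset.sum_congr rfl fun j _ => ?_)
    have h₂ := LinearMap.BilinForm.dualBasis_repr_apply hnd b' ⟨y, hy⟩ j
    rw [LinearMap.BilinForm.dualBasis_dualBasis hnd hBS] at h₂
    rw [map_smul, h₂]
    rfl
  · have h := congrArg S.subtype (b'.sum_repr ⟨y, hy⟩)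
    rw [map_sum] at h
    refine h.symm.trans (Finset.sum_congr rfl fun j _ => ?_)
    rw [map_smul, LinearMap.BilinForm.dualBasis_repr_apply hnd b ⟨y, hy⟩ j]
    rfl
  · have h := LinearMap.BilinForm.apply_dualBasis_left (B := B.restrict S) hnd b i i
    rw [if_pos rfl] at h
    exact h

end Casimir

section Whitehead

open LieAlgebra

variable {k L : Type*} [Field k] [LieRing L] [LieAlgebra k L]

/-- Ideals of a Lie algebra with nondegenerate Killing form are perfect. -/
theorem lie_self_eq_of_isKilling [FiniteDimensional k L] [IsKilling k L] (I : LieIdeal k L) :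
    ⁅I, I⁆ = I := by
  refine le_antisymm (LieSubmodule.lie_le_left I I) fun x hx => ?_
  have hc := LieIdeal.isCompl_killingCompl ⁅I, I⁆
  set K := LieIdeal.killingCompl k L ⁅I, I⁆
  have hab : IsLieAbelian (I ⊓ K : LieIdeal k L) := by
    rw [LieSubmodule.lie_abelian_iff_lie_self_eq_bot, ← le_bot_iff, ← hc.inf_eq_bot]
    exact le_inf (LieSubmodule.mono_lie inf_le_left inf_le_left)
      ((LieSubmodule.lie_le_left _ _).trans inf_le_right)
  have hbot := IsKilling.ideal_eq_bot_of_isLieAbelian (R := k) (I ⊓ K)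
  have hx' : x ∈ ⁅I, I⁆ ⊔ K := by rw [hc.sup_eq_top]; exact LieSubmodule.mem_top x
  obtain ⟨y, hy, z, hz, rfl⟩ := (LieSubmodule.mem_sup _ _ _).1 hx'
  have hz' : z ∈ I ⊓ K := by
    refine (LieSubmodule.mem_inf _ _ _).2 ⟨?_, hz⟩
    have := sub_mem hx (LieSubmodule.lie_le_left I I hy)
    rwa [add_sub_cancel_left] at this
  rw [hbot, LieSubmodule.mem_bot] at hz'
  rwa [hz', add_zero]

variable {M : Type*} [AddCommGroup M] [Module k M] [LieRingModule L M] [LieModule k L M]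

/-- The bilinear map `(a, b) ↦ ⁅b, D a⁆` attached to a linear map `D : L → M`. -/
def actBilin (D : L →ₗ[k] M) : L →ₗ[k] L →ₗ[k] M :=
  (LieModule.toEnd k L M : L →ₗ[k] Module.End k M).flip ∘ₗ D

theorem actBilin_apply (D : L →ₗ[k] M) (a b : L) : actBilin D a b = ⁅b, D a⁆ := rfl

/-- The linear map `a ↦ ⁅a, m⁆`. -/
def actLin (m : M) : L →ₗ[k] M := (LieModule.toEnd k L M : L →ₗ[k] Module.End k M).flip m

theorem actLin_apply (m : M) (a : L) : actLin (k := k) m a = ⁅a, m⁆ := rfl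

/-- An invariant Casimir tensor gives an operator that commutes with the action. -/
theorem casimir_commutes {ι : Type*} [Fintype ι] {e f : ι → L} {x : L} {m : M}
    (h : ∑ i, (⁅f i, ⁅⁅x, e i⁆, m⁆⁆ + ⁅⁅x, f i⁆, ⁅e i, m⁆⁆) = 0) :
    ∑ i, ⁅f i, ⁅e i, ⁅x, m⁆⁆⁆ = ⁅x, ∑ i, ⁅f i, ⁅e i, m⁆⁆⁆ := by
  rw [lie_sum, ← sub_eq_zero, ← neg_eq_zero, neg_sub, ← Finset.sum_sub_distrib, ← h]
  refine Finset.sum_congr rfl fun i _ => ?_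
  rw [leibniz_lie x (f i), leibniz_lie x (e i) m, lie_add]
  abel

/-- The vectors killed by an ideal form a submodule. -/
def idealInvariants (I : LieIdeal k L) (M : Type*) [AddCommGroup M] [Module k M]
    [LieRingModule L M] [LieModule k L M] : LieSubmodule k L M where
  carrier := {m | ∀ d ∈ I, ⁅d, m⁆ = 0}
  add_mem' := fun {a b} ha hb d hd => by rw [lie_add, ha d hd, hb d hd, add_zero]
  zero_mem' := fun d _ => lie_zero d
  smul_mem' := fun c m hm d hd => by rw [lie_smul, hm d hd, smul_zero]
  lie_mem := fun {x m} hm d hd => by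
    rw [leibniz_lie, hm d hd, lie_zero, add_zero]
    exact hm _ (lie_mem_left k L I d x hd)

/-- An ideal on which the trace form of an irreducible module vanishes acts trivially. -/
theorem lie_eq_zero_of_traceForm_eq_zero [CharZero k] [FiniteDimensional k L] [IsKilling k L]
    [FiniteDimensional k M] [LieModule.IsIrreducible k L M] (I : LieIdeal k L)
    (hI : ∀ x ∈ I, ∀ y ∈ I, LieModule.traceForm k L M x y = 0) {x : L} (hx : x ∈ I) (m : M) :
    ⁅x, m⁆ = 0 := by
  have htr : LieModule.traceForm k I M = 0 :=
    LinearMap.ext₂ fun a b => hI a a.2 b b.2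
  have hnil := LieModule.isNilpotent_derivedSeries_of_traceForm_eq_zero htr
  have := LieModule.nontrivial_of_isIrreducible k L M
  have hnt := LieModule.nontrivial_max_triv_of_isNilpotent k (derivedSeries k I 1) M
  obtain ⟨⟨m₀, hm₀⟩, hne⟩ := exists_ne (0 : LieModule.maxTrivSubmodule k (derivedSeries k I 1) M)
  have hm₀' : m₀ ∈ idealInvariants I M := by
    intro d hd
    have hd' : (⟨d, hd⟩ : I) ∈ derivedSeries k I 1 := by
      rw [LieIdeal.derivedSeries_eq_derivedSeriesOfIdeal_comap, LieIdeal.mem_comap,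
        derivedSeriesOfIdeal_succ, derivedSeriesOfIdeal_zero, lie_self_eq_of_isKilling]
      exact hd
    exact hm₀ ⟨⟨d, hd⟩, hd'⟩
  have htop : idealInvariants I M = ⊤ := by
    refine (IsSimpleOrder.eq_bot_or_eq_top _).resolve_left fun h => hne ?_
    rw [h, LieSubmodule.mem_bot] at hm₀'
    exact Subtype.ext hm₀'
  have hm : m ∈ idealInvariants I M := by rw [htop]; exact LieSubmodule.mem_top m
  exact hm x hx

/-- A nontrivial irreducible module over a semisimple Lie algebra has an invertible Casimir
operator. It is taken with respect to the trace form on a complement `I` of the kernel of the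
representation, so that its trace is `dim I`. -/
theorem exists_bijective_casimir [CharZero k] [FiniteDimensional k L] [IsKilling k L]
    [FiniteDimensional k M] [LieModule.IsIrreducible k L M] (hM : ∃ (x : L) (m : M), ⁅x, m⁆ ≠ 0) :
    ∃ (n : ℕ) (e f : Fin n → L),
      (∀ (x : L) (β : L →ₗ[k] L →ₗ[k] M), ∑ i, (β ⁅x, e i⁆ (f i) + β (e i) ⁅x, f i⁆) = 0) ∧
      Function.Bijective (fun m : M => ∑ i, ⁅f i, ⁅e i, m⁆⁆) := by
  set B := LieModule.traceForm k L M with hB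
  have hinv : ∀ x y z, B ⁅x, y⁆ z = -B y ⁅x, z⁆ := LieModule.traceForm_lieInvariant k L M
  have hsymm : ∀ x y, B x y = B y x := LieModule.traceForm_comm k L M
  let R : LieIdeal k L := InvariantForm.orthogonal B (LieModule.traceForm_lieInvariant k L M) ⊤
  have hR : ∀ x, x ∈ R ↔ ∀ y, B y x = 0 := fun x => by
    simp [R, InvariantForm.mem_orthogonal]
  let I : LieIdeal k L := LieIdeal.killingCompl k L R
  have hc : IsCompl R I := LieIdeal.isCompl_killingCompl R
  have hnd : ∀ a ∈ I.toSubmodule, (∀ i ∈ I.toSubmodule, B a i = 0) → a = 0 := by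
    intro a haI ha
    have haR : a ∈ R := by
      rw [hR]
      intro y
      have hy : y ∈ R ⊔ I := by rw [hc.sup_eq_top]; exact LieSubmodule.mem_top y
      obtain ⟨r, hr, i, hi, rfl⟩ := (LieSubmodule.mem_sup _ _ _).1 hy
      rw [map_add, LinearMap.add_apply, hsymm r, (hR r).1 hr, zero_add, hsymm]
      exact ha i hi
    have : a ∈ R ⊓ I := (LieSubmodule.mem_inf _ _ _).2 ⟨haR, haI⟩
    rw [hc.inf_eq_bot, LieSubmodule.mem_bot] at this
    exact this
  obtain ⟨e, f, heI, hfI, hexp, hexp', hdual⟩ := exists_dual_families B hsymm I.toSubmodule hnd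
  have hcas : ∀ (x : L) (β : L →ₗ[k] L →ₗ[k] M),
      ∑ i, (β ⁅x, e i⁆ (f i) + β (e i) ⁅x, f i⁆) = 0 := by
    intro x β
    refine casimir_invariant B hinv hsymm e f x β (fun i y => ?_) (fun i y => ?_)
    · conv_lhs => rw [hexp _ (lie_mem_right k L I x _ (heI i))]
      rw [map_sum, LinearMap.sum_apply]
      simp only [map_smul, LinearMap.smul_apply]
    · conv_lhs => rw [hexp' _ (lie_mem_right k L I x _ (hfI i))]
      rw [map_sum]
      simp only [map_smul]
  refine ⟨_, e, f, hcas, ?_⟩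
  let C : M →ₗ⁅k, L⁆ M :=
    { (∑ i, LieModule.toEnd k L M (f i) * LieModule.toEnd k L M (e i) : Module.End k M) with
      map_lie' := fun {x m} => by
        simpa [LinearMap.sum_apply] using casimir_commutes (hcas x (actBilin (actLin m))) }
  have hC : ∀ m, C m = ∑ i, ⁅f i, ⁅e i, m⁆⁆ := fun m => by
    change (∑ i, LieModule.toEnd k L M (f i) * LieModule.toEnd k L M (e i) : Module.End k M) m = _
    simp [LinearMap.sum_apply]
  have htr : LinearMap.trace k M C = (Module.finrank k I.toSubmodule : k) := by
    have h : ∀ i, LinearMap.trace k M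
        (LieModule.toEnd k L M (f i) * LieModule.toEnd k L M (e i)) = 1 := hdual
    change LinearMap.trace k M
      (∑ i, LieModule.toEnd k L M (f i) * LieModule.toEnd k L M (e i) : Module.End k M) = _
    simp only [map_sum, h]
    simp
  have hker : C.ker = ⊥ := by
    refine (IsSimpleOrder.eq_bot_or_eq_top _).resolve_right fun h => ?_
    have hC0 : (C : M →ₗ[k] M) = 0 := LinearMap.ext fun m =>
      LieModuleHom.mem_ker.1 (by rw [h]; exact LieSubmodule.mem_top m)
    rw [hC0, map_zero, eq_comm, Nat.cast_eq_zero, Submodule.finrank_eq_zero,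
      LieSubmodule.toSubmodule_eq_bot] at htr
    obtain ⟨x, m, hxm⟩ := hM
    refine hxm (lie_eq_zero_of_traceForm_eq_zero R (fun x _ y hy => (hR y).1 hy x) ?_ m)
    have := hc.sup_eq_top
    rw [htr, sup_bot_eq] at this
    rw [this]
    exact LieSubmodule.mem_top x
  have hinj : Function.Injective (C : M →ₗ[k] M) := by
    rw [← LinearMap.ker_eq_bot]
    simpa using congrArg LieSubmodule.toSubmodule hker
  have hCfun : (fun m : M => ∑ i, ⁅f i, ⁅e i, m⁆⁆) = (C : M →ₗ[k] M) :=
    funext fun m => (hC m).symm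
  rw [hCfun]
  exact ⟨hinj, LinearMap.injective_iff_surjective.1 hinj⟩

/-- For a nontrivial module the Casimir operator turns a cocycle into an explicit coboundary; a
cocycle with trivial coefficients vanishes on `[L, L] = L`. -/
theorem firstCohomologyVanishes_of_irreducible [CharZero k] [FiniteDimensional k L] [IsKilling k L]
    [FiniteDimensional k M] [LieModule.IsIrreducible k L M] : FirstCohomologyVanishes k L M := by
  intro D hD
  have hD' := mem_oneCocycle.1 hD
  by_cases hM : ∃ (x : L) (m : M), ⁅x, m⁆ ≠ 0
  · obtain ⟨n, e, f, hcas, hbij⟩ := exists_bijective_casimir (k := k) hM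
    obtain ⟨m, hm⟩ := hbij.2 (∑ i, ⁅f i, D (e i)⁆)
    refine ⟨m, fun x => hbij.1 ?_⟩
    have h := hcas x (actBilin D)
    change _ = ∑ i, ⁅f i, ⁅e i, ⁅x, m⁆⁆⁆
    rw [casimir_commutes (hcas x (actBilin (actLin m))),
      show ∑ i, ⁅f i, ⁅e i, m⁆⁆ = ∑ i, ⁅f i, D (e i)⁆ from hm, lie_sum, ← sub_eq_zero,
      ← neg_eq_zero, neg_sub, ← Finset.sum_sub_distrib, ← h]
    refine Finset.sum_congr rfl fun i _ => ?_
    rw [actBilin_apply, actBilin_apply, hD', lie_sub, leibniz_lie x]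
    abel
  · push Not at hM
    refine ⟨0, fun x => ?_⟩
    rw [lie_zero]
    have hx : x ∈ (⁅(⊤ : LieIdeal k L), (⊤ : LieIdeal k L)⁆ : LieIdeal k L) := by
      rw [lie_self_eq_of_isKilling]
      exact LieSubmodule.mem_top x
    rw [← LieSubmodule.mem_toSubmodule, LieSubmodule.lieIdeal_oper_eq_linear_span'] at hx
    induction hx using Submodule.span_induction with
    | mem u hu =>
      obtain ⟨y, -, z, -, rfl⟩ := hu
      rw [hD', hM, hM, sub_zero]
    | zero => exact map_zero D
    | add u v _ _ hu hv => rw [map_add, hu, hv, add_zero]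
    | smul c u _ hu => rw [map_smul, hu, smul_zero]

/-- **Whitehead's first lemma**. -/
theorem firstCohomologyVanishes_of_isKilling [CharZero k] [FiniteDimensional k L] [IsKilling k L]
    [FiniteDimensional k M] : FirstCohomologyVanishes k L M := by
  refine lieModule_induction (k := k) (L := L)
    (P := fun M _ _ _ _ => FirstCohomologyVanishes k L M) ?_ ?_ ?_ M
  · intro M _ _ _ _ _ D _
    exact ⟨0, fun x => Subsingleton.elim _ _⟩
  · intro M _ _ _ _ _ _
    exact firstCohomologyVanishes_of_irreducible
  · intro M _ _ _ _ N
    exact firstCohomologyVanishes_of_quotient N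

/-- For a nontrivial module the Casimir operator turns a two-cocycle into an explicit coboundary;
trivial coefficients reduce to the first Whitehead lemma for `Hom(L, M)`. -/
theorem secondCohomologyVanishes_of_irreducible [CharZero k] [FiniteDimensional k L]
    [IsKilling k L] [FiniteDimensional k M] [LieModule.IsIrreducible k L M] :
    SecondCohomologyVanishes k L M := by
  intro ω hω
  by_cases hM : ∃ (x : L) (m : M), ⁅x, m⁆ ≠ 0
  · obtain ⟨n, e, f, hcas, hbij⟩ := exists_bijective_casimir (k := k) hM
    let C : M →ₗ[k] M := ∑ i, LieModule.toEnd k L M (f i) * LieModule.toEnd k L M (e i)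
    have hC : ∀ m, C m = ∑ i, ⁅f i, ⁅e i, m⁆⁆ := fun m => by simp [C, LinearMap.sum_apply]
    let Ce : M ≃ₗ[k] M := LinearEquiv.ofBijective C (by rwa [funext hC])
    let h : L →ₗ[k] M := ∑ i, (LieModule.toEnd k L M (f i)) ∘ₗ (ω (e i))
    have hh : ∀ y, h y = ∑ i, ⁅f i, ω (e i) y⁆ := fun y => by simp [h, LinearMap.sum_apply]
    refine ⟨Ce.symm.toLinearMap ∘ₗ h, fun x y => Ce.injective ?_⟩
    have hCe : ∀ m, Ce (Ce.symm m) = m := Ce.apply_symm_apply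
    have hCl : ∀ (x : L) m, Ce ⁅x, m⁆ = ⁅x, Ce m⁆ := fun x m => by
      change C ⁅x, m⁆ = ⁅x, C m⁆
      rw [hC, hC, casimir_commutes (hcas x (actBilin (actLin m)))]
    simp only [map_sub, hCl, LinearMap.comp_apply, LinearEquiv.coe_coe, hCe]
    change C (ω x y) = _
    have h₁ := hcas x (actBilin (ω.flip y))
    have h₂ := hcas y (actBilin (ω.flip x))
    rw [hC, hh, hh, hh, lie_sum, lie_sum, ← sub_eq_zero, ← Finset.sum_sub_distrib,
      ← Finset.sum_sub_distrib, ← Finset.sum_sub_distrib, ← sub_eq_zero.2 (h₂.trans h₁.symm),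
      ← Finset.sum_sub_distrib]
    refine Finset.sum_congr rfl fun i _ => ?_
    have h₃ := congrArg (fun m => ⁅f i, m⁆) (hω.cocycle (e i) x y)
    simp only [lie_sub, lie_add, lie_zero] at h₃
    rw [hω.skew ⁅x, y⁆ (e i), ← lie_skew (e i) x, ← lie_skew (e i) y] at h₃
    simp only [map_neg, LinearMap.neg_apply, lie_neg, sub_neg_eq_add] at h₃
    rw [← sub_eq_zero] at h₃ ⊢
    simp only [actBilin_apply, LinearMap.flip_apply, leibniz_lie x (f i), leibniz_lie y (f i)]
    rw [← h₃]
    abel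
  · push Not at hM
    have hH : FirstCohomologyVanishes k L (L →ₗ[k] M) := firstCohomologyVanishes_of_isKilling
    -- For trivial coefficients `x ↦ ω x` is a one-cocycle with values in `Hom(L, M)`.
    obtain ⟨η, hη⟩ := hH ω (mem_oneCocycle.2 fun x y => LinearMap.ext fun z => by
      have h := hω.cocycle x y z
      rw [hω.skew ⁅x, z⁆ y, hω.skew ⁅y, z⁆ x] at h
      simp only [hM, LinearMap.sub_apply, LieHom.lie_apply] at h ⊢
      rw [← sub_eq_zero, ← neg_eq_zero, ← h]
      abel)
    exact ⟨η, fun x y => by rw [hη, LieHom.lie_apply, hM y, sub_zero]⟩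

/-- **Whitehead's second lemma**. -/
theorem secondCohomologyVanishes_of_isKilling [CharZero k] [FiniteDimensional k L] [IsKilling k L]
    [FiniteDimensional k M] : SecondCohomologyVanishes k L M := by
  refine lieModule_induction (k := k) (L := L)
    (P := fun M _ _ _ _ => SecondCohomologyVanishes k L M) ?_ ?_ ?_ M
  · intro M _ _ _ _ _ ω _
    exact ⟨0, fun x y => Subsingleton.elim _ _⟩
  · intro M _ _ _ _ _ _
    exact secondCohomologyVanishes_of_irreducible
  · intro M _ _ _ _ N
    exact secondCohomologyVanishes_of_quotient N

end Whitehead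

/-! ### Reductive Lie algebras -/

section Reductive

open LieAlgebra

variable {k L : Type*} [Field k] [LieRing L] [LieAlgebra k L]

theorem lie_eq_zero_of_mem_center {x : L} (hx : x ∈ center k L) (y : L) : ⁅x, y⁆ = 0 := by
  rw [← lie_skew, (LieModule.mem_maxTrivSubmodule k L L x).1 hx y, neg_zero]

variable [CharZero k] [FiniteDimensional k L]

/-- The radical of the Killing form of a reductive Lie algebra is its center. -/
theorem mem_center_iff_killingForm [HasCentralRadical k L] (x : L) :
    x ∈ center k L ↔ ∀ y, killingForm k L x y = 0 := by
  constructor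
  · intro hx y
    have h : LieModule.toEnd k L L x = 0 := LinearMap.ext fun z => lie_eq_zero_of_mem_center hx z
    rw [LieModule.traceForm_apply_apply, h, LinearMap.zero_comp, map_zero]
  · intro hx
    rw [← HasCentralRadical.radical_eq_center]
    refine killingCompl_top_le_radical k L ((LieIdeal.mem_killingCompl k L ⊤).2 fun y _ => ?_)
    rw [LieModule.traceForm_comm, hx]

/-- The Casimir operator of the Killing form of a reductive Lie algebra is the identity modulo the
center, vanishes on the center, and commutes with the adjoint action, so it is a projection onto
the derived algebra along the center. -/
theorem exists_casimir_projection [HasCentralRadical k L] :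
    ∃ C : L →ₗ[k] L, (∀ x, C x ∈ semisimplePart k L) ∧
      (∀ x ∈ center k L, C x = 0) ∧ (∀ x y : L, C ⁅x, y⁆ = ⁅x, C y⁆) ∧
      ∀ x, C x - x ∈ center k L := by
  have hinv : ∀ x y z, killingForm k L ⁅x, y⁆ z = -killingForm k L y ⁅x, z⁆ :=
    LieModule.traceForm_lieInvariant k L L
  have hsymm : ∀ x y, killingForm k L x y = killingForm k L y x := LieModule.traceForm_comm k L L
  obtain ⟨S, hS⟩ := Submodule.exists_isCompl (center k L).toSubmodule
  have hdec : ∀ x : L, ∃ z ∈ center k L, ∃ s ∈ S, x = z + s := by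
    intro x
    have hx : x ∈ (center k L).toSubmodule ⊔ S := by rw [hS.sup_eq_top]; trivial
    obtain ⟨z, hz, s, hs, rfl⟩ := Submodule.mem_sup.1 hx
    exact ⟨z, hz, s, hs, rfl⟩
  have hnd : ∀ x ∈ S, (∀ y ∈ S, killingForm k L x y = 0) → x = 0 := by
    intro x hx h
    have hxc : x ∈ center k L := by
      rw [mem_center_iff_killingForm]
      intro y
      obtain ⟨z, hz, s, hs, rfl⟩ := hdec y
      rw [map_add, h s hs, hsymm, (mem_center_iff_killingForm z).1 hz, zero_add]
    exact (Submodule.disjoint_def.1 hS.disjoint) x hxc hx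
  obtain ⟨e, f, -, -, hexp, hexp', -⟩ := exists_dual_families (killingForm k L) hsymm S hnd
  -- The expansions along the dual bases hold for all elements, modulo the center.
  have hc : ∀ y, y - ∑ j, killingForm k L y (f j) • e j ∈ center k L := by
    intro y
    obtain ⟨z, hz, s, hs, rfl⟩ := hdec y
    simp only [map_add, LinearMap.add_apply, (mem_center_iff_killingForm z).1 hz, zero_add]
    rwa [← hexp s hs, add_sub_cancel_right]
  have hc' : ∀ y, y - ∑ j, killingForm k L y (e j) • f j ∈ center k L := by
    intro y
    obtain ⟨z, hz, s, hs, rfl⟩ := hdec y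
    simp only [map_add, LinearMap.add_apply, (mem_center_iff_killingForm z).1 hz, zero_add]
    rwa [← hexp' s hs, add_sub_cancel_right]
  have hlie : ∀ y z : L, ⁅y, z⁆ = ∑ j, killingForm k L y (f j) • ⁅e j, z⁆ := by
    intro y z
    have h := lie_eq_zero_of_mem_center (hc y) z
    rw [sub_lie, sub_eq_zero] at h
    rw [h, sum_lie]
    simp only [smul_lie]
  have hlie' : ∀ y z : L, ⁅y, z⁆ = ∑ j, killingForm k L y (e j) • ⁅f j, z⁆ := by
    intro y z
    have h := lie_eq_zero_of_mem_center (hc' y) z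
    rw [sub_lie, sub_eq_zero] at h
    rw [h, sum_lie]
    simp only [smul_lie]
  have hcas : ∀ x m : L, ∑ i, (⁅f i, ⁅⁅x, e i⁆, m⁆⁆ + ⁅⁅x, f i⁆, ⁅e i, m⁆⁆) = 0 := by
    intro x m
    refine casimir_invariant (killingForm k L) hinv hsymm e f x (actBilin (actLin m))
      (fun i y => ?_) (fun i y => ?_)
    · simp only [actBilin_apply, actLin_apply]
      rw [hlie ⁅x, e i⁆ m, lie_sum]
      simp only [lie_smul]
    · simp only [actBilin_apply]
      rw [hlie' ⁅x, f i⁆]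
  let C : L →ₗ[k] L := ∑ i, LieModule.toEnd k L L (f i) * LieModule.toEnd k L L (e i)
  have hC : ∀ m, C m = ∑ i, ⁅f i, ⁅e i, m⁆⁆ := fun m => by simp [C, LinearMap.sum_apply]
  refine ⟨C, fun x => ?_, fun x hx => ?_, fun x y => ?_, fun x => ?_⟩
  · rw [hC]
    exact sum_mem fun i _ => LieSubmodule.lie_mem_lie (LieSubmodule.mem_top _)
      (LieSubmodule.mem_top _)
  · rw [hC]
    exact Finset.sum_eq_zero fun i _ => by
      rw [(LieModule.mem_maxTrivSubmodule k L L x).1 hx, lie_zero]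
  · rw [hC, hC, casimir_commutes (hcas x y)]
  · rw [mem_center_iff_killingForm]
    intro y
    -- The trace of `ad y ∘ ad x`, computed in the dual bases, is `∑ κ([y, [x, eᵢ]], fᵢ)`.
    have htr : killingForm k L y x = ∑ i, killingForm k L ⁅y, ⁅x, e i⁆⁆ (f i) := by
      rw [LieModule.traceForm_apply_apply]
      have hT : LieModule.toEnd k L L y ∘ₗ LieModule.toEnd k L L x =
          ∑ i, ((killingForm k L).flip (f i)).smulRight ⁅y, ⁅x, e i⁆⁆ := by
        refine LinearMap.ext fun z => ?_
        rw [LinearMap.sum_apply]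
        change ⁅y, ⁅x, z⁆⁆ = ∑ i, killingForm k L z (f i) • ⁅y, ⁅x, e i⁆⁆
        rw [← lie_skew x z, hlie z x, ← Finset.sum_neg_distrib, lie_sum]
        refine Finset.sum_congr rfl fun i _ => ?_
        rw [← smul_neg, lie_skew, lie_smul]
      rw [hT, map_sum]
      exact Finset.sum_congr rfl fun i _ => LinearMap.trace_smulRight _ _
    rw [map_sub, LinearMap.sub_apply, sub_eq_zero, hsymm x y, htr, hC, map_sum,
      LinearMap.sum_apply]
    refine Finset.sum_congr rfl fun i _ => ?_
    rw [LieModule.traceForm_apply_lie_apply, hsymm]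
    congr 2
    rw [← lie_skew, ← lie_skew x, lie_neg]

/-- A reductive Lie algebra projects onto its semisimple part along its center. -/
theorem exists_lieHom_semisimplePart [HasCentralRadical k L] :
    ∃ p : L →ₗ⁅k⁆ semisimplePart k L, (∀ x ∈ center k L, p x = 0) ∧
      (∀ x : semisimplePart k L, p x = x) ∧ ∀ x, (p x : L) - x ∈ center k L := by
  obtain ⟨C, hC, hC₀, hClie, hCid⟩ := exists_casimir_projection (k := k) (L := L)
  have hfix : ∀ y ∈ semisimplePart k L, C y = y := by
    intro y hy
    rw [semisimplePart, ← LieSubmodule.mem_toSubmodule,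
      LieSubmodule.lieIdeal_oper_eq_linear_span'] at hy
    induction hy using Submodule.span_induction with
    | mem u hu =>
      obtain ⟨a, -, b, -, rfl⟩ := hu
      have h := (LieModule.mem_maxTrivSubmodule k L L _).1 (hCid b) a
      rw [lie_sub, sub_eq_zero] at h
      rw [hClie, h]
    | zero => exact map_zero C
    | add u v _ _ hu hv => rw [map_add, hu, hv]
    | smul c u _ hu => rw [map_smul, hu]
  refine ⟨{ C.codRestrict (semisimplePart k L).toSubmodule hC with
            map_lie' := fun {x y} => Subtype.ext ?_ },
    fun x hx => Subtype.ext (hC₀ x hx), fun x => Subtype.ext (hfix x x.2), hCid⟩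
  change C ⁅x, y⁆ = ⁅C x, C y⁆
  have h := lie_eq_zero_of_mem_center (hCid x) (C y)
  rw [sub_lie, sub_eq_zero] at h
  rw [hClie, h]

/-- In a reductive Lie algebra the semisimple part meets the center trivially. -/
theorem eq_zero_of_mem_semisimplePart_of_mem_center [HasCentralRadical k L] {x : L}
    (hx : x ∈ semisimplePart k L) (hxc : x ∈ center k L) : x = 0 := by
  obtain ⟨p, hp₀, hp, -⟩ := exists_lieHom_semisimplePart (k := k) (L := L)
  exact congrArg Subtype.val ((hp ⟨x, hx⟩).symm.trans (hp₀ x hxc))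

/-- The semisimple part of a reductive Lie algebra is semisimple. -/
theorem isKilling_semisimplePart [HasCentralRadical k L] : IsKilling k (semisimplePart k L) := by
  refine ⟨?_⟩
  rw [LieSubmodule.eq_bot_iff]
  rintro x hx
  rw [LieIdeal.mem_killingCompl] at hx
  refine Subtype.ext (eq_zero_of_mem_semisimplePart_of_mem_center x.2 ?_)
  rw [mem_center_iff_killingForm]
  intro y
  obtain ⟨p, -, -, hp⟩ := exists_lieHom_semisimplePart (k := k) (L := L)
  have h₁ := (mem_center_iff_killingForm _).1 (hp y) x
  rw [LieModule.traceForm_comm, map_sub, sub_eq_zero] at h₁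
  have h₂ := hx (p y) (LieSubmodule.mem_top _)
  rw [LieIdeal.killingForm_eq] at h₂
  rw [← h₁, LieModule.traceForm_comm]
  exact h₂

end Reductive

section RadicalNilpotent

open LieAlgebra

variable {k L : Type*} [Field k] [CharZero k] [IsAlgClosed k] [LieRing L] [LieAlgebra k L]
  [FiniteDimensional k L]

/-- `[L, rad L]` acts by zero on irreducible modules, as `rad L` acts by scalars. -/
theorem lie_eq_zero_of_mem_lie_radical {M : Type*} [AddCommGroup M] [Module k M]
    [LieRingModule L M] [LieModule k L M] [FiniteDimensional k M] [LieModule.IsIrreducible k L M]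
    {c : L} (hc : c ∈ ⁅(⊤ : LieIdeal k L), radical k L⁆) (m : M) : ⁅c, m⁆ = 0 := by
  have := LieModule.nontrivial_of_isIrreducible k L M
  obtain ⟨χ, hχ⟩ : ∃ χ : Module.Dual k (radical k L), Nontrivial (LieModule.weightSpace M χ) :=
    LieModule.exists_nontrivial_weightSpace_of_isSolvable k (radical k L) M
  let N : LieSubmodule k L M := LieModule.weightSpaceOfIsLieTower k M χ
  have hN : Nontrivial N := hχ
  have htop : N = ⊤ := N.eq_top_of_isIrreducible k L M
  have hscal : ∀ (r : L) (hr : r ∈ radical k L) (m : M), ⁅r, m⁆ = χ ⟨r, hr⟩ • m := by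
    intro r hr m
    have hm : ∀ (y : L) (hy : y ∈ radical k L), ⁅y, m⁆ = χ ⟨y, hy⟩ • m := by
      simpa [N, LieModule.weightSpaceOfIsLieTower, LieModule.mem_weightSpace] using
        (htop ▸ LieSubmodule.mem_top _ : m ∈ N)
    exact hm r hr
  rw [← LieSubmodule.mem_toSubmodule, LieSubmodule.lieIdeal_oper_eq_linear_span'] at hc
  induction hc using Submodule.span_induction with
  | mem u hu =>
    obtain ⟨a, -, r, hr, rfl⟩ := hu
    rw [lie_lie, hscal r hr, hscal r hr, lie_smul, sub_self]
  | zero => exact zero_lie m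
  | add u v _ _ hu hv => rw [add_lie, hu, hv, add_zero]
  | smul c u _ hu => rw [smul_lie, hu, smul_zero]

/-- The product is zero on every irreducible constituent. -/
theorem isNilpotent_toEnd_mul_of_mem_lie_radical {M : Type*} [AddCommGroup M] [Module k M]
    [LieRingModule L M] [LieModule k L M] [FiniteDimensional k M]
    {c : L} (hc : c ∈ ⁅(⊤ : LieIdeal k L), radical k L⁆) (y : L) :
    IsNilpotent (LieModule.toEnd k L M c * LieModule.toEnd k L M y) := by
  refine lieModule_induction (k := k) (L := L)
    (P := fun M _ _ _ _ => IsNilpotent (LieModule.toEnd k L M c * LieModule.toEnd k L M y))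
    ?_ ?_ ?_ M
  · intro M _ _ _ _ _
    exact ⟨1, LinearMap.ext fun m => Subsingleton.elim _ _⟩
  · intro M _ _ _ _ _ _
    exact ⟨1, LinearMap.ext fun m => by
      rw [pow_one]
      exact lie_eq_zero_of_mem_lie_radical hc ⁅y, m⁆⟩
  · rintro M _ _ _ _ N ⟨q, hq⟩ ⟨p, hp⟩
    have hpN : ∀ m : M,
        ((LieModule.toEnd k L M c * LieModule.toEnd k L M y) ^ p) m ∈ N := by
      intro m
      have h : ∀ (n : ℕ) (m : M),
          LieSubmodule.Quotient.mk' N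
              (((LieModule.toEnd k L M c * LieModule.toEnd k L M y) ^ n) m) =
            ((LieModule.toEnd k L (M ⧸ N) c * LieModule.toEnd k L (M ⧸ N) y) ^ n)
              (LieSubmodule.Quotient.mk' N m) := by
        intro n
        induction n with
        | zero => intro m; rfl
        | succ n ih => intro m; rw [pow_succ, pow_succ]; exact ih _
      rw [← LieSubmodule.Quotient.mk_eq_zero, h, hp]
      rfl
    have hqN : ∀ m ∈ N, ((LieModule.toEnd k L M c * LieModule.toEnd k L M y) ^ q) m = 0 := by
      intro m hm
      have h : ∀ (n : ℕ) (m : N),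
          ((((LieModule.toEnd k L N c * LieModule.toEnd k L N y) ^ n) m : N) : M) =
            ((LieModule.toEnd k L M c * LieModule.toEnd k L M y) ^ n) m := by
        intro n
        induction n with
        | zero => intro m; rfl
        | succ n ih => intro m; rw [pow_succ, pow_succ]; exact ih _
      rw [← h q ⟨m, hm⟩, hq]
      rfl
    exact ⟨q + p, LinearMap.ext fun m => by rw [pow_add]; exact hqN _ (hpN m)⟩

/-- The ideal `[L, rad L]` lies in the radical of every trace form. -/
theorem traceForm_eq_zero_of_mem_lie_radical (M : Type*) [AddCommGroup M] [Module k M]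
    [LieRingModule L M] [LieModule k L M] [FiniteDimensional k M]
    {c : L} (hc : c ∈ ⁅(⊤ : LieIdeal k L), radical k L⁆) (y : L) :
    LieModule.traceForm k L M c y = 0 :=
  (LinearMap.isNilpotent_trace_of_isNilpotent
    (isNilpotent_toEnd_mul_of_mem_lie_radical (M := M) hc y)).eq_zero

end RadicalNilpotent

section Isotropy

open LieAlgebra

variable {k A 𝔤 : Type u} {Γ : Type w} [Field k] [CharZero k] [CommRing A]
  [Algebra k A] [LieRing 𝔤] [LieAlgebra k 𝔤] [Group Γ] [Finite Γ]
  (φ : Γ →* (A ≃ₐ[k] A)) (ψ : Γ →* (𝔤 ≃ₗ⁅k⁆ 𝔤)) (x : A →ₐ[k] k)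

/-- By averaging over the isotropy group, an element of `𝔤^x` orthogonal to `𝔤^x` under the Killing
form of `𝔤` is orthogonal to `𝔤`. -/
theorem killingForm_eq_zero_of_isotropy {c : 𝔤} (hc : c ∈ isotropyAlgebra φ ψ x)
    (h : ∀ y ∈ isotropyAlgebra φ ψ x, killingForm k 𝔤 c y = 0) (y : 𝔤) :
    killingForm k 𝔤 c y = 0 := by
  classical
  have := Fintype.ofFinite (isotropyGroup φ x)
  have hmem : ∑ γ : isotropyGroup φ x, ψ γ y ∈ isotropyAlgebra φ ψ x := by
    intro δ hδ
    rw [map_sum]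
    refine Fintype.sum_equiv (Equiv.mulLeft (⟨δ, hδ⟩ : isotropyGroup φ x)) _ _ fun γ => ?_
    rw [Equiv.coe_mulLeft, Subgroup.coe_mul, map_mul, lieAut_mul_apply]
  have h₁ := h _ hmem
  have h₂ : ∀ γ : isotropyGroup φ x, killingForm k 𝔤 c (ψ γ y) = killingForm k 𝔤 c y := by
    intro γ
    have h₃ := killingForm_of_equiv_apply (ψ γ) c y
    rwa [show ψ γ c = c from hc γ γ.2] at h₃
  rw [map_sum, Finset.sum_congr rfl fun γ _ => h₂ γ, Finset.sum_const, smul_eq_zero] at h₁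
  exact h₁.resolve_left Fintype.card_ne_zero

/-- The isotropy algebras of a finite group acting on a reductive Lie algebra are reductive. -/
theorem hasCentralRadical_isotropyAlgebra [IsAlgClosed k] [FiniteDimensional k 𝔤]
    [HasCentralRadical k 𝔤] : HasCentralRadical k (isotropyAlgebra φ ψ x) := by
  refine hasCentralRadical_of_radical_le k _ fun r hr => ?_
  rw [LieModule.mem_maxTrivSubmodule]
  intro a
  have hc : ⁅a, r⁆ ∈ ⁅(⊤ : LieIdeal k (isotropyAlgebra φ ψ x)),
      radical k (isotropyAlgebra φ ψ x)⁆ := LieSubmodule.lie_mem_lie (LieSubmodule.mem_top a) hr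
  refine Subtype.ext (eq_zero_of_mem_semisimplePart_of_mem_center (k := k) ?_ ?_)
  · exact LieSubmodule.lie_mem_lie (LieSubmodule.mem_top (a : 𝔤)) (LieSubmodule.mem_top (r : 𝔤))
  · rw [mem_center_iff_killingForm]
    exact killingForm_eq_zero_of_isotropy φ ψ x (Subtype.property _) fun y hy =>
      traceForm_eq_zero_of_mem_lie_radical 𝔤 hc ⟨y, hy⟩

end Isotropy

/-! ### Inflation and restriction -/

section InflationRestriction

variable {k L Q M : Type*} [Field k] [LieRing L] [LieAlgebra k L] [LieRing Q] [LieAlgebra k Q]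
  [AddCommGroup M] [Module k M] [LieRingModule L M] [LieModule k L M]
  [LieRingModule Q M]
  (π : L →ₗ⁅k⁆ Q)

/-- A cocycle of `L` that vanishes on the kernel of `L → Q` is a coboundary if `H¹(Q, M) = 0`. -/
theorem exists_coboundary_of_eq_zero_on_ker [LieModule k Q M] (hπ : Function.Surjective π)
    (hM : ∀ (l : L) (m : M), ⁅π l, m⁆ = ⁅l, m⁆) (h₁ : FirstCohomologyVanishes k Q M)
    {D : L →ₗ[k] M} (hD : D ∈ oneCocycle k L M) (hDπ : ∀ a, π a = 0 → D a = 0) :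
    ∃ m : M, ∀ l, D l = ⁅l, m⁆ := by
  rw [mem_oneCocycle] at hD
  obtain ⟨σ, hσ⟩ := (π : L →ₗ[k] Q).exists_rightInverse_of_surjective (LinearMap.range_eq_top.2 hπ)
  have hσ' : ∀ q, π (σ q) = q := LinearMap.congr_fun hσ
  have hDσ : ∀ l q, π l = q → D (σ q) = D l := by
    intro l q hl
    rw [← sub_eq_zero, ← map_sub]
    exact hDπ _ (by rw [map_sub, hσ', hl, sub_self])
  obtain ⟨m, hm⟩ := h₁ (D ∘ₗ σ) (mem_oneCocycle.2 fun x y => by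
    change D (σ ⁅x, y⁆) = ⁅x, D (σ y)⁆ - ⁅y, D (σ x)⁆
    rw [hDσ ⁅σ x, σ y⁆ _ (by rw [LieHom.map_lie, hσ', hσ']), hD, ← hM, ← hM, hσ', hσ'])
  refine ⟨m, fun l => ?_⟩
  rw [← hM, ← hm]
  exact (hDσ l _ rfl).symm

/-- An equivariant map on the kernel of `L → Q` extends to a cocycle of `L` if `H²(Q, M) = 0`. -/
theorem exists_oneCocycle_eq_on_ker (hπ : Function.Surjective π)
    (hM : ∀ (l : L) (m : M), ⁅π l, m⁆ = ⁅l, m⁆) (h₂ : SecondCohomologyVanishes k Q M)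
    (ρ : L →ₗ[k] M) (hρ : ∀ l a : L, π a = 0 → ρ ⁅l, a⁆ = ⁅l, ρ a⁆) :
    ∃ D ∈ oneCocycle k L M, ∀ a, π a = 0 → D a = ρ a := by
  obtain ⟨σ, hσ⟩ := (π : L →ₗ[k] Q).exists_rightInverse_of_surjective (LinearMap.range_eq_top.2 hπ)
  have hσ' : ∀ q, π (σ q) = q := LinearMap.congr_fun hσ
  set ω := (LieModule.Cohomology.d₁₂ k L M ρ).1 with hω
  have hωc : IsTwoCocycle ω := isTwoCocycle_d ρ
  have hω₁ : ∀ x y, ω x y = ⁅x, ρ y⁆ - ⁅y, ρ x⁆ - ρ ⁅x, y⁆ := fun _ _ => rfl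
  -- `dρ` is the inflation of a two-cocycle of `Q`.
  have hω₀ : ∀ x a, π a = 0 → ω x a = 0 := by
    intro x a ha
    rw [hω₁, hρ x a ha, ← hM a, ha, zero_lie, sub_zero, sub_self]
  have hωr : ∀ x y y', π y = π y' → ω x y = ω x y' := by
    intro x y y' h
    rw [← sub_eq_zero, ← map_sub]
    exact hω₀ _ _ (by rw [map_sub, h, sub_self])
  have hωl : ∀ x x' y, π x = π x' → ω x y = ω x' y := by
    intro x x' y h
    rw [hωc.skew x, hωc.skew x', hωr y x x' h]
  obtain ⟨η, hη⟩ := h₂ (ω.compl₁₂ σ σ)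
    { alt := fun x => hωc.alt _
      cocycle := fun x y z => by
        have hb : ∀ x y z : Q, ω (σ ⁅x, y⁆) (σ z) = ω ⁅σ x, σ y⁆ (σ z) := fun x y z =>
          hωl _ _ _ (by rw [LieHom.map_lie, hσ', hσ', hσ'])
        simp only [LinearMap.compl₁₂_apply]
        rw [hb, hb, hb]
        have h := hωc.cocycle (σ x) (σ y) (σ z)
        rwa [← hM (σ x), ← hM (σ y), ← hM (σ z), hσ', hσ', hσ'] at h }
  refine ⟨ρ - η ∘ₗ (π : L →ₗ[k] Q), mem_oneCocycle.2 fun x y => ?_, fun a ha => ?_⟩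
  · have h := hη (π x) (π y)
    rw [LinearMap.compl₁₂_apply, hωl _ x _ (hσ' _), hωr _ _ y (hσ' _), hω₁, hM, hM] at h
    have hη' : ∀ l, (ρ - η ∘ₗ (π : L →ₗ[k] Q)) l = ρ l - η (π l) := fun _ => rfl
    rw [hη', hη', hη', lie_sub, lie_sub, LieHom.map_lie, ← sub_eq_zero,
      ← neg_eq_zero, ← sub_eq_zero.2 h]
    abel
  · change ρ a - η (π a) = ρ a
    rw [ha, map_zero, sub_zero]

end InflationRestriction

section DualTensor

variable {k G V V' : Type*} [Field k] [LieRing G] [LieAlgebra k G]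
  [AddCommGroup V] [Module k V] [LieRingModule G V] [LieModule k G V]
  [AddCommGroup V'] [Module k V'] [LieRingModule G V'] [LieModule k G V']

/-- The canonical map `V* ⊗ V' → Hom(V, V')` is equivariant. -/
theorem dualTensorHom_lie (g : G) (t : Module.Dual k V ⊗[k] V') :
    dualTensorHom k V V' ⁅g, t⁆ = ⁅g, dualTensorHom k V V' t⁆ := by
  induction t with
  | zero => exact (congrArg (dualTensorHom k V V') (lie_zero g)).trans (by simp)
  | add s t hs ht =>
    have h : ⁅g, s + t⁆ = ⁅g, s⁆ + ⁅g, t⁆ := lie_add g s t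
    rw [map_add, lie_add, ← hs, ← ht, ← map_add]
    exact congrArg _ h
  | tmul ξ v =>
    refine LinearMap.ext fun u => ?_
    rw [TensorProduct.LieModule.lie_tmul_right, map_add, LinearMap.add_apply, LieHom.lie_apply,
      dualTensorHom_apply, dualTensorHom_apply, dualTensorHom_apply, dualTensorHom_apply,
      lie_smul, Module.Dual.lie_apply, neg_smul]
    abel

end DualTensor

namespace IdealAb

variable {k L G : Type*} [Field k] [LieRing L] [LieAlgebra k L] [LieRing G] [LieAlgebra k G]
  {f : L →ₗ⁅k⁆ G} {hf : Function.Surjective f} {J : LieIdeal k L} {hJ : f.ker ≤ J}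

/-- The linear map on `J_ab` induced by a linear map on `J` that vanishes on `[J, J]`. -/
def lift {T : Type*} [AddCommGroup T] [Module k T] (F : J →ₗ[k] T)
    (hF : ∀ a : J, (a : L) ∈ (⁅J, J⁆ : LieIdeal k L) → F a = 0) : IdealAb f hf J hJ →ₗ[k] T :=
  (derivedIn J).toSubmodule.liftQ F hF

variable (f hf J hJ) in
/-- The quotient map `J → J_ab` as a linear map. -/
def mkLinear : J →ₗ[k] IdealAb f hf J hJ where
  toFun := mk
  map_add' := mk_add
  map_smul' := mk_smul

end IdealAb

section ExtHom

variable {k L G Q V V' : Type u} [Field k] [LieRing L] [LieAlgebra k L] [LieRing G]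
  [LieAlgebra k G] [LieRing Q] [LieAlgebra k Q]
  [AddCommGroup V] [Module k V] [FiniteDimensional k V]
  [AddCommGroup V'] [Module k V']
  [LieRingModule L V] [LieModule k L V] [LieRingModule L V'] [LieModule k L V']
  [LieRingModule G V] [LieModule k G V] [LieRingModule G V'] [LieModule k G V']
  [LieRingModule Q V] [LieModule k Q V] [LieRingModule Q V'] [LieModule k Q V']

/-- If `J` acts trivially on `Hom(V, V')` and `H¹` and `H²` of `Q = L / J` with coefficients in
`Hom(V, V')` vanish, then restriction of cocycles to `J` identifies `Ext¹_L(V, V')` with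
`Hom_G(J_ab, V* ⊗ V')`. -/
theorem nonempty_extOne_equiv_hom (f : L →ₗ⁅k⁆ G) (hf : Function.Surjective f)
    (J : LieIdeal k L) (hJ : f.ker ≤ J) (hV : ∀ (l : L) (v : V), ⁅f l, v⁆ = ⁅l, v⁆)
    (hV' : ∀ (l : L) (v : V'), ⁅f l, v⁆ = ⁅l, v⁆)
    (π : L →ₗ⁅k⁆ Q) (hπ : Function.Surjective π) (hπJ : ∀ l, π l = 0 ↔ l ∈ J)
    (hM : ∀ (l : L) (m : V →ₗ[k] V'), ⁅π l, m⁆ = ⁅l, m⁆)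
    (h₁ : FirstCohomologyVanishes k Q (V →ₗ[k] V'))
    (h₂ : SecondCohomologyVanishes k Q (V →ₗ[k] V')) :
    Nonempty (ExtOne k L V V' ≃ₗ[k]
      (IdealAb f hf J hJ →ₗ⁅k, G⁆ Module.Dual k V ⊗[k] V')) := by
  have hG : ∀ (l : L) (m : V →ₗ[k] V'), ⁅f l, m⁆ = ⁅l, m⁆ := fun l m =>
    LinearMap.ext fun v => by rw [LieHom.lie_apply, LieHom.lie_apply, hV, hV']
  have hJM : ∀ a ∈ J, ∀ m : V →ₗ[k] V', ⁅a, m⁆ = 0 := fun a ha m => by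
    rw [← hM, (hπJ a).2 ha, zero_lie]
  let e : Module.Dual k V ⊗[k] V' ≃ₗ[k] (V →ₗ[k] V') := dualTensorHomEquiv k V V'
  have he : ∀ (g : G) t, e ⁅g, t⁆ = ⁅g, e t⁆ := fun g t => dualTensorHom_lie g t
  have he' : ∀ (g : G) m, e.symm ⁅g, m⁆ = ⁅g, e.symm m⁆ := fun g m => e.injective (by
    rw [he, e.apply_symm_apply, e.apply_symm_apply])
  have hDJ : ∀ D ∈ oneCocycle k L (V →ₗ[k] V'), ∀ a ∈ (⁅J, J⁆ : LieIdeal k L), D a = 0 := by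
    intro D hD a ha
    rw [← LieSubmodule.mem_toSubmodule, LieSubmodule.lieIdeal_oper_eq_linear_span'] at ha
    induction ha using Submodule.span_induction with
    | mem u hu =>
      obtain ⟨a, ha, b, hb, rfl⟩ := hu
      rw [mem_oneCocycle.1 hD, hJM a ha, hJM b hb, sub_zero]
    | zero => exact map_zero D
    | add u v _ _ hu hv => rw [map_add, hu, hv, add_zero]
    | smul c u _ hu => rw [map_smul, hu, smul_zero]
  let res : oneCocycle k L (V →ₗ[k] V') →
      (IdealAb f hf J hJ →ₗ⁅k, G⁆ Module.Dual k V ⊗[k] V') := fun D =>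
    { IdealAb.lift (e.symm.toLinearMap ∘ₗ D.1 ∘ₗ J.toSubmodule.subtype)
        (fun a ha => (congrArg e.symm (hDJ D.1 D.2 a ha)).trans (map_zero _)) with
      map_lie' := fun {g n} => by
        obtain ⟨l, rfl⟩ := hf g
        obtain ⟨a, rfl⟩ := IdealAb.mk_surjective n
        rw [IdealAb.lie_mk]
        change e.symm (D.1 ⁅l, (a : L)⁆) = ⁅f l, e.symm (D.1 a)⁆
        rw [mem_oneCocycle.1 D.2, hJM a a.2, sub_zero, ← he', hG] }
  have hres : ∀ D (a : J), res D (IdealAb.mk a) = e.symm (D.1 a) := fun _ _ => rfl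
  let Ψ : oneCocycle k L (V →ₗ[k] V') →ₗ[k]
      (IdealAb f hf J hJ →ₗ⁅k, G⁆ Module.Dual k V ⊗[k] V') :=
    { toFun := res
      map_add' := fun D D' => LieModuleHom.ext fun n => by
        obtain ⟨a, rfl⟩ := IdealAb.mk_surjective n
        rw [LieModuleHom.add_apply, hres, hres, hres, ← map_add]
        rfl
      map_smul' := fun c D => LieModuleHom.ext fun n => by
        obtain ⟨a, rfl⟩ := IdealAb.mk_surjective n
        rw [RingHom.id_apply, LieModuleHom.smul_apply, hres, hres, ← map_smul]
        rfl }
  refine nonempty_extOne_equiv Ψ (fun F => ?_) fun D => ⟨fun hD => ?_, ?_⟩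
  · obtain ⟨ρ, hρ⟩ := LinearMap.exists_extend
      (e.toLinearMap ∘ₗ (F : IdealAb f hf J hJ →ₗ[k] _) ∘ₗ IdealAb.mkLinear f hf J hJ)
    have hρ' : ∀ a : J, ρ a = e (F (IdealAb.mk a)) := LinearMap.congr_fun hρ
    obtain ⟨D, hD, hDρ⟩ := exists_oneCocycle_eq_on_ker π hπ hM h₂ ρ (fun l a ha => by
      have haJ := (hπJ a).1 ha
      have h := hρ' ⁅l, (⟨a, haJ⟩ : J)⁆
      rw [← IdealAb.lie_mk, LieModuleHom.map_lie, he, ← hρ', hG] at h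
      exact h)
    refine ⟨⟨D, hD⟩, LieModuleHom.ext fun n => ?_⟩
    obtain ⟨a, rfl⟩ := IdealAb.mk_surjective n
    change e.symm (D a) = _
    rw [hDρ a ((hπJ a).2 a.2), hρ', e.symm_apply_apply]
  · refine exists_coboundary_of_eq_zero_on_ker π hπ hM h₁ D.2 fun a ha => ?_
    have h : e.symm (D.1 a) = 0 :=
      LieModuleHom.congr_fun hD (IdealAb.mk (⟨a, (hπJ a).1 ha⟩ : J))
    exact e.symm.map_eq_zero_iff.1 h
  · rintro ⟨θ, hθ⟩
    refine LieModuleHom.ext fun n => ?_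
    obtain ⟨a, rfl⟩ := IdealAb.mk_surjective n
    change e.symm (D.1 a) = 0
    rw [hθ, hJM a a.2, map_zero]

end ExtHom

/-! ### Representations of a reductive Lie algebra and of its semisimple part -/

section Reductive

variable {k G : Type*} [Field k] [LieRing G] [LieAlgebra k G]

/-- If the center of a reductive Lie algebra acts trivially on two modules, then a linear map
between them is equivariant as soon as it is equivariant under the semisimple part. -/
theorem nonempty_hom_equiv_hom_semisimplePart [CharZero k] [FiniteDimensional k G]
    [LieAlgebra.HasCentralRadical k G] {N T : Type*}
    [AddCommGroup N] [Module k N] [LieRingModule G N] [LieModule k G N]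
    [AddCommGroup T] [Module k T] [LieRingModule G T] [LieModule k G T]
    (hzN : ∀ z ∈ LieAlgebra.center k G, ∀ n : N, ⁅z, n⁆ = 0)
    (hzT : ∀ z ∈ LieAlgebra.center k G, ∀ t : T, ⁅z, t⁆ = 0) :
    Nonempty ((N →ₗ⁅k, G⁆ T) ≃ₗ[k] (N →ₗ⁅k, semisimplePart k G⁆ T)) := by
  obtain ⟨p, -, -, hp⟩ := exists_lieHom_semisimplePart (k := k) (L := G)
  have hpN : ∀ (g : G) (n : N), ⁅(p g : G), n⁆ = ⁅g, n⁆ := fun g n => by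
    rw [← sub_eq_zero, ← sub_lie, hzN _ (hp g)]
  have hpT : ∀ (g : G) (t : T), ⁅(p g : G), t⁆ = ⁅g, t⁆ := fun g t => by
    rw [← sub_eq_zero, ← sub_lie, hzT _ (hp g)]
  exact ⟨{
    toFun := fun F =>
      { (F : N →ₗ[k] T) with
        map_lie' := fun {i n} => F.map_lie (i : G) n }
    invFun := fun F =>
      { (F : N →ₗ[k] T) with
        map_lie' := fun {g n} => by
          change F ⁅g, n⁆ = ⁅g, F n⁆
          rw [← hpN, ← hpT]
          exact F.map_lie (p g) n }
    map_add' := fun _ _ => rfl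
    map_smul' := fun _ _ => rfl
    left_inv := fun _ => rfl
    right_inv := fun _ => rfl }⟩

variable {V V' : Type*}
  [AddCommGroup V] [Module k V] [LieRingModule G V] [LieModule k G V]
  [AddCommGroup V'] [Module k V'] [LieRingModule G V'] [LieModule k G V']

theorem lie_linearMap_eq_smul {z : G} {a b : k} (ha : ∀ v : V, ⁅z, v⁆ = a • v)
    (hb : ∀ v : V', ⁅z, v⁆ = b • v) (m : V →ₗ[k] V') : ⁅z, m⁆ = (b - a) • m :=
  LinearMap.ext fun v => by
    rw [LieHom.lie_apply, hb, ha, map_smul, LinearMap.smul_apply, sub_smul]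

theorem lie_dual_tensor_eq_zero [FiniteDimensional k V] {z : G} {a : k}
    (ha : ∀ v : V, ⁅z, v⁆ = a • v) (hb : ∀ v : V', ⁅z, v⁆ = a • v)
    (t : Module.Dual k V ⊗[k] V') : ⁅z, t⁆ = 0 := by
  refine (dualTensorHomEquiv k V V').injective ((dualTensorHom_lie z t).trans ?_)
  rw [lie_linearMap_eq_smul ha hb, sub_self, zero_smul, map_zero]

end Reductive

/-! ### Extensions of representations with a central character -/

section CentralCharacter

variable {k L G V V' : Type u} [Field k] [LieRing L] [LieAlgebra k L] [LieRing G]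
  [LieAlgebra k G]
  [AddCommGroup V] [Module k V] [FiniteDimensional k V]
  [AddCommGroup V'] [Module k V']
  [LieRingModule L V] [LieModule k L V] [LieRingModule L V'] [LieModule k L V']
  [LieRingModule G V] [LieModule k G V] [LieRingModule G V'] [LieModule k G V']

/-- Extensions of representations of `G` on which the center acts by different characters: a central
element at which these differ acts on `Hom(V, V')` by a nonzero scalar. -/
theorem nonempty_extOne_equiv_of_ne (f : L →ₗ⁅k⁆ G) (hf : Function.Surjective f)
    (hJ : f.ker ≤ f.ker) (hV : ∀ (l : L) (v : V), ⁅f l, v⁆ = ⁅l, v⁆)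
    (hV' : ∀ (l : L) (v : V'), ⁅f l, v⁆ = ⁅l, v⁆)
    {lam lam' : Module.Dual k (LieAlgebra.center k G)}
    (hlam : ∀ (z : LieAlgebra.center k G) (v : V), ⁅z, v⁆ = lam z • v)
    (hlam' : ∀ (z : LieAlgebra.center k G) (v : V'), ⁅z, v⁆ = lam' z • v) (hne : lam ≠ lam') :
    Nonempty (ExtOne k L V V' ≃ₗ[k]
      (IdealAb f hf f.ker hJ →ₗ⁅k, G⁆ Module.Dual k V ⊗[k] V')) := by
  obtain ⟨z, hz⟩ : ∃ z, lam z ≠ lam' z := by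
    by_contra! h
    exact hne (LinearMap.ext h)
  have hzG : ∀ g : G, ⁅(z : G), g⁆ = 0 := fun g => lie_eq_zero_of_mem_center z.2 g
  have hc : lam' z - lam z ≠ 0 := sub_ne_zero.2 hz.symm
  have hzM : ∀ m : V →ₗ[k] V', ⁅(z : G), m⁆ = (lam' z - lam z) • m :=
    lie_linearMap_eq_smul (hlam z) (hlam' z)
  exact nonempty_extOne_equiv_hom f hf f.ker hJ hV hV' f hf (fun l => LieHom.mem_ker.symm)
    (fun l m => LinearMap.ext fun v => by rw [LieHom.lie_apply, LieHom.lie_apply, hV, hV'])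
    (firstCohomologyVanishes_of_central hzG hc hzM)
    (secondCohomologyVanishes_of_central hzG hc hzM)

variable [CharZero k] [FiniteDimensional k G] [FiniteDimensional k V']

/-- Extensions of representations of a semisimple quotient `G` of `L`, by Whitehead's lemmas. -/
theorem nonempty_extOne_equiv_of_isKilling [LieAlgebra.IsKilling k G]
    (f : L →ₗ⁅k⁆ G) (hf : Function.Surjective f)
    (hJ : f.ker ≤ f.ker) (hV : ∀ (l : L) (v : V), ⁅f l, v⁆ = ⁅l, v⁆)
    (hV' : ∀ (l : L) (v : V'), ⁅f l, v⁆ = ⁅l, v⁆) :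
    Nonempty (ExtOne k L V V' ≃ₗ[k]
      (IdealAb f hf f.ker hJ →ₗ⁅k, G⁆ Module.Dual k V ⊗[k] V')) :=
  nonempty_extOne_equiv_hom f hf f.ker hJ hV hV' f hf (fun l => LieHom.mem_ker.symm)
    (fun l m => LinearMap.ext fun v => by rw [LieHom.lie_apply, LieHom.lie_apply, hV, hV'])
    firstCohomologyVanishes_of_isKilling secondCohomologyVanishes_of_isKilling

/-- Extensions of representations of a reductive quotient `G` of `L` on which the center of `G`
acts by the same character. The cocycles are restricted to the preimage `J` of the center, with
quotient the semisimple part of `G`. -/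
theorem nonempty_extOne_equiv_of_eq [LieAlgebra.HasCentralRadical k G]
    (f : L →ₗ⁅k⁆ G) (hf : Function.Surjective f) (J : LieIdeal k L)
    (hJ : f.ker ≤ J) (hJz : ∀ l, l ∈ J ↔ f l ∈ LieAlgebra.center k G)
    (hV : ∀ (l : L) (v : V), ⁅f l, v⁆ = ⁅l, v⁆)
    (hV' : ∀ (l : L) (v : V'), ⁅f l, v⁆ = ⁅l, v⁆)
    {lam : Module.Dual k (LieAlgebra.center k G)}
    (hlam : ∀ (z : LieAlgebra.center k G) (v : V), ⁅z, v⁆ = lam z • v)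
    (hlam' : ∀ (z : LieAlgebra.center k G) (v : V'), ⁅z, v⁆ = lam z • v) :
    Nonempty (ExtOne k L V V' ≃ₗ[k]
      (IdealAb f hf J hJ →ₗ⁅k, semisimplePart k G⁆ Module.Dual k V ⊗[k] V')) := by
  obtain ⟨p, hpz, hpi, hp⟩ := exists_lieHom_semisimplePart (k := k) (L := G)
  have hzM : ∀ z ∈ LieAlgebra.center k G, ∀ m : V →ₗ[k] V', ⁅z, m⁆ = 0 := fun z hz m => by
    refine (lie_linearMap_eq_smul (hlam ⟨z, hz⟩) (hlam' ⟨z, hz⟩) m).trans ?_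
    rw [sub_self, zero_smul]
  have := isKilling_semisimplePart (k := k) (L := G)
  obtain ⟨e⟩ := nonempty_extOne_equiv_hom f hf J hJ hV hV' (p.comp f)
    (fun i => by
      obtain ⟨l, hl⟩ := hf (i : G)
      exact ⟨l, (congrArg p hl).trans (hpi i)⟩)
    (fun l => by
      rw [hJz, LieHom.comp_apply]
      refine ⟨fun h => ?_, hpz _⟩
      have h' := hp (f l)
      rw [h, ZeroMemClass.coe_zero, zero_sub] at h'
      simpa using neg_mem h')
    (fun l m => by
      have h : ⁅(p (f l) : G), m⁆ = ⁅f l, m⁆ := by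
        rw [← sub_eq_zero, ← sub_lie, hzM _ (hp _)]
      refine LinearMap.ext fun v => (LinearMap.congr_fun h v).trans ?_
      rw [LieHom.lie_apply, LieHom.lie_apply, hV, hV'])
    firstCohomologyVanishes_of_isKilling secondCohomologyVanishes_of_isKilling
  obtain ⟨e'⟩ := nonempty_hom_equiv_hom_semisimplePart
    (N := IdealAb f hf J hJ) (G := G) (T := Module.Dual k V ⊗[k] V')
    (fun z hz n => by
      obtain ⟨a, rfl⟩ := hf z
      obtain ⟨b, rfl⟩ := IdealAb.mk_surjective n
      rw [IdealAb.lie_mk, IdealAb.mk_eq_zero]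
      exact LieSubmodule.lie_mem_lie ((hJz a).2 hz) b.2)
    (fun z hz t => lie_dual_tensor_eq_zero (hlam ⟨z, hz⟩) (hlam' ⟨z, hz⟩) t)
  exact ⟨e.trans e'⟩

end CentralCharacter

section Evaluation

variable {k A 𝔤 : Type u} {Γ : Type w} [Field k] [CharZero k] [CommRing A] [Algebra k A]
  [LieRing 𝔤] [LieAlgebra k 𝔤] [Group Γ] [Finite Γ]
  (φ : Γ →* (A ≃ₐ[k] A)) (ψ : Γ →* (𝔤 ≃ₗ⁅k⁆ 𝔤)) (x : A →ₐ[k] k)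

theorem mem_centEv_iff (α : equivariantMapAlgebra φ ψ) :
    α ∈ centEv φ ψ x ↔ ∀ β : equivariantMapAlgebra φ ψ, ⁅α, β⁆ ∈ kerEv φ ψ x := by
  have h : ∀ β, ⁅α, β⁆ ∈ kerEv φ ψ x ↔ ⁅ev φ ψ x α, ev φ ψ x β⁆ = 0 := fun β => by
    rw [kerEv, LieHom.mem_ker, LieHom.map_lie]
  simp only [h]
  rw [← (ev_surjective φ ψ x).forall (p := fun g => ⁅ev φ ψ x α, g⁆ = 0), centEv,
    LieIdeal.mem_comap]
  refine ⟨fun hα g => lie_eq_zero_of_mem_center hα g, fun hα =>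
    (LieModule.mem_maxTrivSubmodule _ _ _ _).2 fun g => ?_⟩
  rw [← lie_skew, hα, neg_zero]

end Evaluation

end EquivariantMap

theorem theorem3p10
    {k A 𝔤 : Type u} {Γ : Type w} [Field k] [IsAlgClosed k] [CharZero k]
    [CommRing A] [Algebra k A] [Algebra.FiniteType k A]
    [LieRing 𝔤] [LieAlgebra k 𝔤] [FiniteDimensional k 𝔤] [LieAlgebra.HasCentralRadical k 𝔤]
    [Group Γ] [Finite Γ] (φ : Γ →* (A ≃ₐ[k] A)) (ψ : Γ →* (𝔤 ≃ₗ⁅k⁆ 𝔤))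
    (x : A →ₐ[k] k)
    (V V' : Type u)
    [AddCommGroup V] [Module k V] [FiniteDimensional k V]
    [LieRingModule (isotropyAlgebra φ ψ x) V] [LieModule k (isotropyAlgebra φ ψ x) V]
    [LieModule.IsIrreducible k (isotropyAlgebra φ ψ x) V]
    [AddCommGroup V'] [Module k V'] [FiniteDimensional k V']
    [LieRingModule (isotropyAlgebra φ ψ x) V'] [LieModule k (isotropyAlgebra φ ψ x) V']
    [LieModule.IsIrreducible k (isotropyAlgebra φ ψ x) V']
    (lam lam' : Module.Dual k (LieAlgebra.center k (isotropyAlgebra φ ψ x)))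
    (hlam : ∀ (z : LieAlgebra.center k (isotropyAlgebra φ ψ x)) (v : V), ⁅z, v⁆ = lam z • v)
    (hlam' : ∀ (z : LieAlgebra.center k (isotropyAlgebra φ ψ x)) (v : V'), ⁅z, v⁆ = lam' z • v) :
    (∀ α : equivariantMapAlgebra φ ψ,
      α ∈ centEv φ ψ x ↔ ∀ β : equivariantMapAlgebra φ ψ, ⁅α, β⁆ ∈ kerEv φ ψ x) ∧
    (lam ≠ lam' →
      Nonempty
        (ExtOne k (equivariantMapAlgebra φ ψ) (EvalRep φ ψ x V) (EvalRep φ ψ x V') ≃ₗ[k]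
          (KerAb φ ψ x →ₗ⁅k, isotropyAlgebra φ ψ x⁆ Module.Dual k V ⊗[k] V'))) ∧
    (lam = lam' →
      Nonempty
        (ExtOne k (equivariantMapAlgebra φ ψ) (EvalRep φ ψ x V) (EvalRep φ ψ x V') ≃ₗ[k]
          (CentAb φ ψ x →ₗ⁅k, semisimplePart k (isotropyAlgebra φ ψ x)⁆
            Module.Dual k V ⊗[k] V'))) ∧
    (LieAlgebra.IsSemisimple k (isotropyAlgebra φ ψ x) →
      semisimplePart k (isotropyAlgebra φ ψ x) = ⊤ ∧ lam = 0 ∧ lam' = 0 ∧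
      kerEv φ ψ x = centEv φ ψ x ∧
      Nonempty
        (ExtOne k (equivariantMapAlgebra φ ψ) (EvalRep φ ψ x V) (EvalRep φ ψ x V') ≃ₗ[k]
          (KerAb φ ψ x →ₗ⁅k, isotropyAlgebra φ ψ x⁆ Module.Dual k V ⊗[k] V'))) := by
  let : LieRingModule (equivariantMapAlgebra φ ψ) V := LieRingModule.compLieHom V (ev φ ψ x)
  let : LieRingModule (equivariantMapAlgebra φ ψ) V' := LieRingModule.compLieHom V' (ev φ ψ x)
  let : LieModule k (equivariantMapAlgebra φ ψ) V := LieModule.compLieHom V (ev φ ψ x)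
  let : LieModule k (equivariantMapAlgebra φ ψ) V' := LieModule.compLieHom V' (ev φ ψ x)
  have hV : ∀ (α : equivariantMapAlgebra φ ψ) (v : V), ⁅ev φ ψ x α, v⁆ = ⁅α, v⁆ :=
    fun _ _ => rfl
  have hV' : ∀ (α : equivariantMapAlgebra φ ψ) (v : V'), ⁅ev φ ψ x α, v⁆ = ⁅α, v⁆ :=
    fun _ _ => rfl
  have hfin : FiniteDimensional k (isotropyAlgebra φ ψ x) :=
    inferInstanceAs (FiniteDimensional k (isotropyAlgebra φ ψ x).toSubmodule)
  have hred := hasCentralRadical_isotropyAlgebra φ ψ x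
  refine ⟨mem_centEv_iff φ ψ x, fun hne => ?_, fun heq => ?_, fun hss => ?_⟩
  · exact nonempty_extOne_equiv_of_ne (V := V) (V' := V') (ev φ ψ x) (ev_surjective φ ψ x)
      (ker_le_kerEv φ ψ x) hV hV' hlam hlam' hne
  · subst heq
    exact nonempty_extOne_equiv_of_eq (V := V) (V' := V') (ev φ ψ x) (ev_surjective φ ψ x)
      (centEv φ ψ x) (ker_le_centEv φ ψ x) (fun _ => LieIdeal.mem_comap) hV hV' hlam hlam'
  · have hcenter : LieAlgebra.center k (isotropyAlgebra φ ψ x) = ⊥ := LieAlgebra.center_eq_bot k _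
    have hzero : ∀ z : LieAlgebra.center k (isotropyAlgebra φ ψ x), z = 0 := fun z =>
      Subtype.ext ((LieSubmodule.mem_bot _).1 (hcenter.le z.2))
    refine ⟨lie_self_eq_of_isKilling ⊤, LinearMap.ext fun z => by rw [hzero z, map_zero, map_zero],
      LinearMap.ext fun z => by rw [hzero z, map_zero, map_zero], ?_, ?_⟩
    · refine SetLike.ext fun α => ?_
      rw [kerEv, centEv, LieHom.mem_ker, LieIdeal.mem_comap, hcenter, LieSubmodule.mem_bot]
    · exact nonempty_extOne_equiv_of_isKilling (V := V) (V' := V') (ev φ ψ x) (ev_surjective φ ψ x)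
        (ker_le_kerEv φ ψ x) hV hV'
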